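/- Let $n\ge 1$ and let $B_n^+$ be the monoid of positive $n$-strand braids, presented by generators $\sigma_1,\dots,\sigma_{n-1}$ and relations $\sigma_i\sigma_j=\sigma_j\sigma_i$ for $|i-j|\ge 2$, $\sigma_i\sigma_j\sigma_i=\sigma_j\sigma_i\sigma_j$ for $|i-j|=1$. Let $\Delta_n$ be the fundamental braid, given by $\Delta_1=1$ and $\Delta_n=\sigma_1\sigma_2\cdots\sigma_{n-1}\Delta_{n-1}$. A simple $n$-braid is a left divisor of $\Delta_n$ in $B_n^+$. A sequence $(x_1,\dots,x_d)$ of simple $n$-braids is called normal if $x_k$ is the greatest common left divisor of $\Delta_n$ and $x_kx_{k+1}\cdots x_d$ for every $k$. Each positive $n$-braid is the product of a normal sequence, which is unique once it is extended on the right by infinitely many trivial factors $1$; the $d$-th entry of the extended sequence is the $d$-th factor of the braid, and the braid has degree at most $d$ if all its factors after the $d$-th one are $1$. For $d\ge 1$ and $x$ a simple $n$-braid, let $b_{n,d}(x)$ be the number of positive $n$-braids of degree at most $d$ whose $d$-th factor is $x$; put $b_{n,0}(x)=1$ if $x=\Delta_n$ and $b_{n,0}(x)=0$ otherwise. Let $M_n$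 be the $n!\times n!$ matrix indexed by the simple $n$-braids, whose $(x,y)$-entry is $1$ if $(x,y)$ is normal and $0$ otherwise. Let $\rho_1,\dots,\rho_k$ be the distinct nonzero complex eigenvalues of $M_n$. Then, for each simple $n$-braid $x$: 1. there exist polynomials $P_1,\dots,P_k\in\mathbb{C}[X]$, with $\deg P_i$ at most the multiplicity of $\rho_i$ as a root of the characteristic polynomial of $M_n$, such that for every integer $d\ge 0$ $$b_{n,d}(x)=P_1(d)\,\rho_1^d+\dots+P_k(d)\,\rho_k^d;$$ 2. the generating function $\sum_{d\ge 0} b_{n,d}(x)\,z^d$ is rational: there are $p,q\in\mathbb{Q}[z]$ with $q(0)\ne 0$ such that $q(z)\sum_{d\ge 0} b_{n,d}(x)z^d=p(z)$ in $\mathbb{Q}[[z]]$. -/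

import Mathlib

open scoped Polynomial PowerSeries

/-- The defining relations of the `n` strand braid monoid. The letter `i : Fin (n - 1)` stands for
the generator `σ_{i+1}`. -/
inductive BraidRel (n : ℕ) : FreeMonoid (Fin (n - 1)) → FreeMonoid (Fin (n - 1)) → Prop
  | comm (i j : Fin (n - 1)) (h : (i : ℕ) + 2 ≤ j) :
      BraidRel n (FreeMonoid.of i * FreeMonoid.of j) (FreeMonoid.of j * FreeMonoid.of i)
  | braid (i j : Fin (n - 1)) (h : (i : ℕ) + 1 = j) :
      BraidRel n (FreeMonoid.of i * FreeMonoid.of j * FreeMonoid.of i)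
        (FreeMonoid.of j * FreeMonoid.of i * FreeMonoid.of j)

/-- The monoid `B_n^+` of positive `n` strand braids. Since it is a noncommutative monoid, `x ∣ y`
means `∃ z, y = x * z`, that is, `x` is a left divisor of `y`. -/
abbrev PosBraid (n : ℕ) : Type := PresentedMonoid (BraidRel n)

/-- The word for `Δ_{m+1}` in `σ_1, …, σ_m`:
`Δ_1 = 1` and `Δ_{m+2} = σ_1 σ_2 ⋯ σ_{m+1} Δ_{m+1}`. -/
def deltaWord : (m : ℕ) → FreeMonoid (Fin m)
  | 0 => 1
  | m + 1 => FreeMonoid.ofList (List.finRange (m + 1)) * FreeMonoid.map Fin.castSucc (deltaWord m)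

/-- The fundamental braid `Δ_n`. -/
def deltaBraid (n : ℕ) : PosBraid n := PresentedMonoid.mk (BraidRel n) (deltaWord (n - 1))

/-- Simple `n`-braids: the (left) divisors of `Δ_n` in `B_n^+`. -/
abbrev SimpleBraid (n : ℕ) : Type := {x : PosBraid n // x ∣ deltaBraid n}

/-- `g` is the greatest common left divisor of `a` and `b`. -/
def IsLeftGcd {n : ℕ} (g a b : PosBraid n) : Prop :=
  g ∣ a ∧ g ∣ b ∧ ∀ c : PosBraid n, c ∣ a → c ∣ b → c ∣ g

/-- The sequence `(x_1, …, x_d)` is normal: `x_k = gcd (Δ_n, x_k ⋯ x_d)` for every `k`.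
In particular all the entries are simple. -/
def IsNormal {n : ℕ} : List (PosBraid n) → Prop
  | [] => True
  | x :: l => IsLeftGcd x (deltaBraid n) (x * l.prod) ∧ IsNormal l

/-- `s` is the normal form of the positive braid `z`, made infinite on the right by trivial
factors `1`. Here `s k` is the `(k+1)`-st factor of `z`. -/
def IsNormalForm {n : ℕ} (z : PosBraid n) (s : ℕ → PosBraid n) : Prop :=
  ∃ N : ℕ, (∀ k, N ≤ k → s k = 1) ∧
    IsNormal ((List.range N).map s) ∧ ((List.range N).map s).prod = z

/-- For `d ≥ 1`: the positive `n`-braids of degree at most `d` (all the factors of the normal form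
after the `d`-th one are trivial) whose `d`-th factor is `x`. -/
def braidsWithFactor (n d : ℕ) (x : SimpleBraid n) : Set (PosBraid n) :=
  {z | ∃ s : ℕ → PosBraid n, IsNormalForm z s ∧ (∀ k, d ≤ k → s k = 1) ∧ s (d - 1) = x}

open Classical in
/-- The number `b_{n,d}(x)` of positive `n`-braids of degree at most `d` with `d`-th factor `x`,
for `d ≥ 1`. For `d = 0` the usual convention is `b_{n,0}(x) = 1` if `x = Δ_n` and `0` otherwise
(think of a normal form as preceded by factors `Δ_n`). -/
noncomputable def braidCount (n d : ℕ) (x : SimpleBraid n) : ℕ :=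
  if d = 0 then (if (x : PosBraid n) = deltaBraid n then 1 else 0)
  else (braidsWithFactor n d x).ncard

section Finiteness

/-- Word length, as a homomorphism. -/
def braidLength (n : ℕ) : PosBraid n →* Multiplicative ℕ :=
  PresentedMonoid.lift (fun _ => Multiplicative.ofAdd 1) (by
    intro a b h
    cases h <;> simp)

theorem braidLength_mk (n : ℕ) (w : FreeMonoid (Fin (n - 1))) :
    braidLength n (PresentedMonoid.mk (BraidRel n) w) = Multiplicative.ofAdd w.length := by
  induction w using FreeMonoid.inductionOn' with
  | one => simp
  | of_mul a w ih =>
    rw [map_mul, map_mul, ih, FreeMonoid.length_mul, ofAdd_add, FreeMonoid.length_of]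
    rfl

theorem finite_simpleBraid (n : ℕ) : Finite (SimpleBraid n) := by
  have hfin : {w : List (Fin (n - 1)) | w.length ≤ (deltaWord (n - 1)).length}.Finite :=
    List.finite_length_le _ _
  refine Set.Finite.to_subtype (Set.Finite.subset
    (hfin.image fun w => PresentedMonoid.mk (BraidRel n) (FreeMonoid.ofList w)) ?_)
  rintro x ⟨y, hy⟩
  obtain ⟨w, rfl⟩ := PresentedMonoid.surjective_mk x
  refine ⟨w.toList, ?_, rfl⟩
  have h := congrArg (braidLength n) hy
  rw [map_mul, deltaBraid, braidLength_mk, braidLength_mk] at h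
  have h' : (deltaWord (n - 1)).length = w.length + (braidLength n y).toAdd :=
    congrArg Multiplicative.toAdd h
  change w.length ≤ _
  omega

noncomputable instance instFintypeSimpleBraid (n : ℕ) : Fintype (SimpleBraid n) :=
  haveI := finite_simpleBraid n
  Fintype.ofFinite _

theorem IsNormal.dvd_delta {n : ℕ} {l : List (PosBraid n)} (h : IsNormal l) :
    ∀ x ∈ l, x ∣ deltaBraid n := by
  induction l with
  | nil => simp
  | cons a l ih =>
    intro x hx
    rcases List.mem_cons.1 hx with rfl | hx
    · exact h.1.1
    · exact ih h.2 x hx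

theorem prod_range_of_trivial {n : ℕ} {s : ℕ → PosBraid n} {d : ℕ} (h : ∀ k, d ≤ k → s k = 1)
    (e : ℕ) : ((List.range (d + e)).map s).prod = ((List.range d).map s).prod := by
  induction e with
  | zero => rfl
  | succ e ih => rw [← add_assoc, List.range_succ]; simp [ih, h (d + e) (by omega)]

/-- The sets that are counted are finite, so that their cardinality is meaningful. -/
theorem finite_braidsWithFactor (n d : ℕ) (x : SimpleBraid n) :
    (braidsWithFactor n d x).Finite := by
  have := finite_simpleBraid n
  have hfin : (Set.range fun f : Fin d → SimpleBraid n =>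
      (List.ofFn fun i => (f i : PosBraid n)).prod).Finite := Set.finite_range _
  refine hfin.subset ?_
  rintro z ⟨s, ⟨N, hN, hnorm, rfl⟩, hd, -⟩
  have hs : ∀ k, s k ∣ deltaBraid n := by
    intro k
    rcases lt_or_ge k N with hk | hk
    · exact hnorm.dvd_delta _ (List.mem_map.2 ⟨k, List.mem_range.2 hk, rfl⟩)
    · rw [hN k hk]; exact one_dvd _
  refine ⟨fun i => ⟨s i, hs i⟩, ?_⟩
  have h1 := prod_range_of_trivial hd N
  have h2 := prod_range_of_trivial hN d
  rw [add_comm N d, h1] at h2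
  rw [← h2, ← List.map_coe_finRange_eq_range, List.map_map]
  exact congrArg List.prod List.ofFn_eq_map

end Finiteness

open Classical in
/-- The `n! × n!` incidence matrix `M_n`, indexed by the simple braids: the `(x, y)`-entry is `1` if
`(x, y)` is normal, and `0` otherwise. -/
noncomputable def normalMatrix (n : ℕ) : Matrix (SimpleBraid n) (SimpleBraid n) ℂ :=
  Matrix.of fun x y => if IsNormal [(x : PosBraid n), (y : PosBraid n)] then 1 else 0

open Classical in
/-- The characteristic polynomial of `M_n`. -/
noncomputable def normalCharpoly (n : ℕ) : ℂ[X] := (normalMatrix n).charpoly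

/-- The finite set of the (distinct) nonzero complex eigenvalues of `M_n`. -/
noncomputable def nonzeroEigenvalues (n : ℕ) : Finset ℂ := (normalCharpoly n).roots.toFinset.erase 0

/-! ### Adjacent transpositions and inversion numbers. -/

section Permutations

open Equiv

/-! Simple braids correspond to permutations, and a pair `(x, y)` is normal exactly when the
descents of `y⁻¹` are descents of `x` (`isNormal_pair_iff`). Normality is a condition on
neighbouring entries, and every pair `(Δ, x)` is normal, so `b_{n,d}(x)` is the `(Δ, x)`-entry of
`M_n ^ d`, also for `d = 0` (`braidCount_eq_pow_apply`). Rationality of the generating function then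
follows from Cayley-Hamilton.

The exponential formula is more delicate, because it is claimed for every `d ≥ 0`: a nilpotent part
of `M_n` could spoil it for small `d`. What has to be shown is that the eigenvalue `0` does not
contribute to the orbit of the basis vector at `Δ` under the transpose `T` of `M_n`. The proof
exhibits a `T`-stable space that contains this vector and on which `T` is injective, namely the
functions of `x` that depend only on the type (the conjugacy class of the Young subgroup) of the
descent set of `x⁻¹`.

Both properties come from double cosets. After Möbius inversion over subsets, `T` is given by the
numbers of permutations `x` with `U` among the descents of `x⁻¹` and `T` among those of `x`. Such
`x` are the longest elements of the double cosets of the Young subgroups of `U` and `T`, and by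
Burnside's lemma their number is the inner product of the two permutation characters
(`sum_conjCount_mul_conjCount`). Hence it depends only on the types (`descentTransfer_sameType`).
The inner product is positive definite, and the characters of distinct types are linearly
independent by triangularity at Coxeter elements (`type_sum_eq_zero`), which gives injectivity
(`eq_zero_of_descentTransfer_eq_zero`).

The dictionary between braids and permutations rests on Garside's analysis of `σ_i A = σ_j B`
(`lcmFactor_of_mul_eq`) and on Matsumoto's theorem (`Reduced.ext`). -/

/-- The adjacent transposition exchanging `i` and `i + 1`. -/
def adjSwap {m : ℕ} (i : Fin m) : Perm (Fin (m + 1)) := Equiv.swap i.castSucc i.succ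

/-- The number of inversions of a permutation. -/
def invNum {n : ℕ} (w : Perm (Fin n)) : ℕ :=
  (Finset.univ.filter fun p : Fin n × Fin n => p.1 < p.2 ∧ w p.2 < w p.1).card

theorem adjSwap_mul_self {m : ℕ} (i : Fin m) : adjSwap i * adjSwap i = 1 :=
  Equiv.swap_mul_self _ _

@[simp] theorem adjSwap_inv {m : ℕ} (i : Fin m) : (adjSwap i)⁻¹ = adjSwap i :=
  Equiv.swap_inv _ _

@[simp] theorem adjSwap_castSucc {m : ℕ} (i : Fin m) : adjSwap i i.castSucc = i.succ :=
  Equiv.swap_apply_left _ _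

@[simp] theorem adjSwap_succ {m : ℕ} (i : Fin m) : adjSwap i i.succ = i.castSucc :=
  Equiv.swap_apply_right _ _

theorem adjSwap_of_ne {m : ℕ} {i : Fin m} {p : Fin (m + 1)} (h1 : (p : ℕ) ≠ i)
    (h2 : (p : ℕ) ≠ i + 1) : adjSwap i p = p :=
  Equiv.swap_apply_of_ne_of_ne (by rintro rfl; simp at h1) (by rintro rfl; simp at h2)

theorem adjSwap_val {m : ℕ} (i : Fin m) (p : Fin (m + 1)) :
    (adjSwap i p : ℕ) = if (p : ℕ) = i then (i : ℕ) + 1 else if (p : ℕ) = i + 1 then (i : ℕ) else p := by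
  simp only [adjSwap, Equiv.swap_apply_def, Fin.ext_iff, Fin.val_castSucc, Fin.val_succ]
  split_ifs <;> simp

theorem adjSwap_comm {m : ℕ} {i j : Fin m} (h : (i : ℕ) + 2 ≤ j) :
    adjSwap i * adjSwap j = adjSwap j * adjSwap i := by
  ext p
  simp only [Perm.mul_apply, adjSwap_val]
  split_ifs <;> omega

theorem adjSwap_braid {m : ℕ} {i j : Fin m} (h : (i : ℕ) + 1 = j) :
    adjSwap i * adjSwap j * adjSwap i = adjSwap j * adjSwap i * adjSwap j := by
  have hij : j.castSucc = i.succ := by ext; simp [h]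
  have h1 : i.castSucc ≠ i.succ := by simp [Fin.ext_iff]
  have h2 : j.succ ≠ i.succ := by simp [Fin.ext_iff]; omega
  have h3 : j.succ ≠ i.castSucc := by simp [Fin.ext_iff]; omega
  have e1 := swap_mul_swap_mul_swap h2 h3
  have e2 := swap_mul_swap_mul_swap h1 h3.symm
  simp only [adjSwap, hij]
  rw [e2, swap_comm i.castSucc i.succ, swap_comm i.succ j.succ, e1, swap_comm]

/-- The transposition keeps the order of every pair of positions except `{i, i + 1}`, so it carries
the inversions of `w` to those of the product, and the pair `(i, i + 1)` is the only new one. -/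
theorem invNum_mul_adjSwap_of_lt {m : ℕ} {w : Perm (Fin (m + 1))} {i : Fin m}
    (h : w i.castSucc < w i.succ) : invNum (w * adjSwap i) = invNum w + 1 := by
  classical
  have hinj : Function.Injective (Prod.map (adjSwap i) (adjSwap i)) :=
    (adjSwap i).injective.prodMap (adjSwap i).injective
  have key : (Finset.univ.filter fun p : Fin (m + 1) × Fin (m + 1) =>
        p.1 < p.2 ∧ (w * adjSwap i) p.2 < (w * adjSwap i) p.1) =
      insert (i.castSucc, i.succ) ((Finset.univ.filter fun p : Fin (m + 1) × Fin (m + 1) =>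
        p.1 < p.2 ∧ w p.2 < w p.1).image (Prod.map (adjSwap i) (adjSwap i))) := by
    have hself : ∀ p, adjSwap i (adjSwap i p) = p := fun p => by
      rw [← Perm.mul_apply, adjSwap_mul_self]; rfl
    have himg : ∀ p q : Fin (m + 1), (p, q) ∈ ((Finset.univ.filter
        fun p : Fin (m + 1) × Fin (m + 1) => p.1 < p.2 ∧ w p.2 < w p.1).image
          (Prod.map (adjSwap i) (adjSwap i))) ↔
        adjSwap i p < adjSwap i q ∧ w (adjSwap i q) < w (adjSwap i p) := by
      intro p q
      simp only [Finset.mem_image, Finset.mem_filter, Finset.mem_univ, true_and, Prod.exists,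
        Prod.map_apply, Prod.mk.injEq]
      constructor
      · rintro ⟨a, b, hab, rfl, rfl⟩
        simpa [hself] using hab
      · intro hpq
        exact ⟨_, _, hpq, hself p, hself q⟩
    ext ⟨p, q⟩
    rw [Finset.mem_insert, himg]
    rw [Finset.mem_filter, Perm.mul_apply, Perm.mul_apply, Prod.mk.injEq]
    simp only [Finset.mem_univ, true_and]
    by_cases h1 : p = i.castSucc ∧ q = i.succ
    · obtain ⟨rfl, rfl⟩ := h1
      simpa [Perm.mul_apply] using h
    by_cases h2 : p = i.succ ∧ q = i.castSucc
    · obtain ⟨rfl, rfl⟩ := h2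
      have h4 : ¬ i.succ < i.castSucc := by simp [Fin.lt_def]
      have h5 : i.castSucc ≠ i.succ := by simp [Fin.ext_iff]
      simp [h.not_gt, h4, h5]
    · rw [or_iff_right h1]
      have : p < q ↔ adjSwap i p < adjSwap i q := by
        simp only [Fin.ext_iff, Fin.val_succ, Fin.val_castSucc] at h1 h2
        rw [Fin.lt_def, Fin.lt_def, adjSwap_val, adjSwap_val]
        split_ifs <;> omega
      rw [this]
  rw [invNum, key, Finset.card_insert_of_notMem, Finset.card_image_of_injective _ hinj, invNum]
  rw [Finset.mem_image]
  rintro ⟨⟨a, b⟩, hab, he⟩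
  simp only [Finset.mem_filter, Finset.mem_univ, true_and, Prod.map_apply, Prod.mk.injEq] at hab he
  have ha : a = i.succ := (adjSwap i).injective (by rw [he.1, adjSwap_succ])
  have hb : b = i.castSucc := (adjSwap i).injective (by rw [he.2, adjSwap_castSucc])
  subst ha hb
  have := hab.1
  simp [Fin.lt_def] at this

theorem invNum_mul_adjSwap_of_gt {m : ℕ} {w : Perm (Fin (m + 1))} {i : Fin m}
    (h : w i.succ < w i.castSucc) : invNum (w * adjSwap i) + 1 = invNum w := by
  have := invNum_mul_adjSwap_of_lt (w := w * adjSwap i) (i := i) (by simpa using h)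
  rw [← this, mul_assoc, adjSwap_mul_self, mul_one]

theorem apply_castSucc_ne_succ {m : ℕ} (w : Perm (Fin (m + 1))) (i : Fin m) :
    w i.castSucc ≠ w i.succ := fun h => by
  have := congrArg Fin.val (w.injective h)
  simp at this

theorem invNum_mul_adjSwap_le {m : ℕ} (w : Perm (Fin (m + 1))) (i : Fin m) :
    invNum (w * adjSwap i) ≤ invNum w + 1 := by
  rcases (apply_castSucc_ne_succ w i).lt_or_gt with h | h
  · exact (invNum_mul_adjSwap_of_lt h).le
  · have := invNum_mul_adjSwap_of_gt h
    omega

theorem invNum_mul_adjSwap_lt_iff {m : ℕ} (w : Perm (Fin (m + 1))) (i : Fin m) :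
    invNum (w * adjSwap i) = invNum w + 1 ↔ w i.castSucc < w i.succ := by
  refine ⟨fun h => ?_, invNum_mul_adjSwap_of_lt⟩
  by_contra h'
  have := invNum_mul_adjSwap_of_gt (lt_of_le_of_ne (not_lt.1 h') (apply_castSucc_ne_succ w i).symm)
  omega

theorem invNum_inv {n : ℕ} (w : Perm (Fin n)) : invNum w⁻¹ = invNum w := by
  refine Finset.card_bij' (fun p _ => (w⁻¹ p.2, w⁻¹ p.1)) (fun p _ => (w p.2, w p.1)) ?_ ?_ ?_ ?_
  · simp +contextual
  · simp +contextual
  · simp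
  · simp

@[simp] theorem invNum_one {n : ℕ} : invNum (1 : Perm (Fin n)) = 0 := by
  rw [invNum, Finset.card_eq_zero, Finset.filter_eq_empty_iff]
  rintro ⟨p, q⟩ - ⟨h1, h2⟩
  exact lt_asymm h1 h2

theorem exists_descent {m : ℕ} {w : Perm (Fin (m + 1))} (hw : w ≠ 1) :
    ∃ i : Fin m, w i.succ < w i.castSucc := by
  by_contra! h
  have hmono : StrictMono w := Fin.strictMono_iff_lt_succ.2 fun i =>
    lt_of_le_of_ne (h i) (apply_castSucc_ne_succ w i)
  apply hw
  ext p
  have : (hmono.orderIsoOfSurjective w w.surjective) = OrderIso.refl _ := Subsingleton.elim _ _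
  have h2 := congrArg (fun e : Fin (m + 1) ≃o Fin (m + 1) => e p) this
  exact congrArg Fin.val h2

theorem eq_revPerm_of_descents {m : ℕ} {w : Perm (Fin (m + 1))}
    (h : ∀ i : Fin m, w i.succ < w i.castSucc) : w = Fin.revPerm := by
  by_contra hw
  have hne : Fin.revPerm * w ≠ 1 := by
    intro h1
    apply hw
    have h3 : w = Fin.revPerm⁻¹ := eq_inv_of_mul_eq_one_right h1
    rw [h3]
    ext p
    rfl
  obtain ⟨i, hi⟩ := exists_descent hne
  simp only [Perm.mul_apply, Fin.revPerm_apply, Fin.rev_lt_rev] at hi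
  exact lt_asymm hi (h i)

theorem invNum_le {n : ℕ} (w : Perm (Fin n)) : invNum w ≤ n * n := by
  refine (Finset.card_le_univ _).trans ?_
  simp

theorem invNum_revPerm (n : ℕ) : invNum (Fin.revPerm : Perm (Fin n)) = n * (n - 1) / 2 := by
  have h1 : invNum (Fin.revPerm : Perm (Fin n)) = ∑ q : Fin n, (q : ℕ) := by
    rw [invNum, Finset.card_filter, Fintype.sum_prod_type_right]
    refine Finset.sum_congr rfl fun q _ => ?_
    simp only [Fin.revPerm_apply, Fin.rev_lt_rev, and_self]
    rw [← Finset.card_filter]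
    rw [← Fin.card_Iio q]
    congr 1
    ext
    simp
  rw [h1, Fin.sum_univ_eq_sum_range (fun i => i), Finset.sum_range_id]

end Permutations

/-! ### Garside's lemma on common multiples of two generators, and left cancellation. -/

section Garside

variable {m : ℕ}

/-- The generator `σ_{i+1}`. -/
def gen (i : Fin m) : PosBraid (m + 1) := PresentedMonoid.of (BraidRel (m + 1)) i

/-- Word length of a positive braid. -/
def len (x : PosBraid (m + 1)) : ℕ := (braidLength (m + 1) x).toAdd

def Far (i j : Fin m) : Prop := (i : ℕ) + 2 ≤ j ∨ (j : ℕ) + 2 ≤ i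

def Adjacent (i j : Fin m) : Prop := (i : ℕ) + 1 = j ∨ (j : ℕ) + 1 = i

theorem Far.symm {i j : Fin m} (h : Far i j) : Far j i := Or.symm h

theorem Adjacent.symm {i j : Fin m} (h : Adjacent i j) : Adjacent j i := Or.symm h

theorem eq_or_far_or_adjacent (i j : Fin m) : i = j ∨ Far i j ∨ Adjacent i j := by
  simp only [Far, Adjacent, Fin.ext_iff]
  omega

theorem len_mul (x y : PosBraid (m + 1)) : len (x * y) = len x + len y := by
  simp [len]

@[simp] theorem len_one : len (1 : PosBraid (m + 1)) = 0 := by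
  simp [len]

@[simp] theorem len_gen (i : Fin m) : len (gen i) = 1 := rfl

theorem len_mk (w : FreeMonoid (Fin m)) :
    len (PresentedMonoid.mk (BraidRel (m + 1)) w) = w.length := by
  exact congrArg Multiplicative.toAdd (braidLength_mk (m + 1) w)

theorem gen_comm {i j : Fin m} (h : Far i j) : gen i * gen j = gen j * gen i := by
  have aux : ∀ {i j : Fin m}, (i : ℕ) + 2 ≤ j → gen i * gen j = gen j * gen i :=
    fun {i j} h => PresentedMonoid.mk_eq_mk_of_rel (BraidRel.comm (n := m + 1) i j h)
  rcases h with h | h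
  · exact aux h
  · exact (aux h).symm

theorem gen_braid {i j : Fin m} (h : Adjacent i j) :
    gen i * gen j * gen i = gen j * gen i * gen j := by
  have aux : ∀ {i j : Fin m}, (i : ℕ) + 1 = j → gen i * gen j * gen i = gen j * gen i * gen j :=
    fun {i j} h => PresentedMonoid.mk_eq_mk_of_rel (BraidRel.braid (n := m + 1) i j h)
  rcases h with h | h
  · exact aux h
  · exact (aux h).symm

theorem gen_comm' {i j : Fin m} (h : Far i j) (x : PosBraid (m + 1)) :
    gen i * (gen j * x) = gen j * (gen i * x) := by
  rw [← mul_assoc, gen_comm h, mul_assoc]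

theorem gen_braid' {i j : Fin m} (h : Adjacent i j) (x : PosBraid (m + 1)) :
    gen i * (gen j * (gen i * x)) = gen j * (gen i * (gen j * x)) := by
  have := congrArg (· * x) (gen_braid h)
  simpa only [mul_assoc] using this

/-- The pairs `(A, B)` such that `σ_i A = σ_j B` follows from factoring through the right lcm of
`σ_i` and `σ_j`. -/
def LcmFactor (i : Fin m) (A : PosBraid (m + 1)) (j : Fin m) (B : PosBraid (m + 1)) : Prop :=
  (i = j ∧ A = B) ∨
  (Far i j ∧ ∃ C, A = gen j * C ∧ B = gen i * C) ∨
  (Adjacent i j ∧ ∃ C, A = gen j * (gen i * C) ∧ B = gen i * (gen j * C))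

theorem LcmFactor.symm {i j : Fin m} {A B : PosBraid (m + 1)} (h : LcmFactor i A j B) :
    LcmFactor j B i A := by
  rcases h with ⟨rfl, rfl⟩ | ⟨h, C, rfl, rfl⟩ | ⟨h, C, rfl, rfl⟩
  · exact Or.inl ⟨rfl, rfl⟩
  · exact Or.inr (Or.inl ⟨h.symm, C, rfl, rfl⟩)
  · exact Or.inr (Or.inr ⟨h.symm, C, rfl, rfl⟩)

theorem LcmFactor.mul_right {i j : Fin m} {A B : PosBraid (m + 1)} (h : LcmFactor i A j B)
    (x : PosBraid (m + 1)) : LcmFactor i (A * x) j (B * x) := by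
  rcases h with ⟨rfl, rfl⟩ | ⟨h, C, rfl, rfl⟩ | ⟨h, C, rfl, rfl⟩
  · exact Or.inl ⟨rfl, rfl⟩
  · exact Or.inr (Or.inl ⟨h, C * x, by simp only [mul_assoc], by simp only [mul_assoc]⟩)
  · exact Or.inr (Or.inr ⟨h, C * x, by simp only [mul_assoc], by simp only [mul_assoc]⟩)

theorem Far.not_eq {i j : Fin m} (h : Far i j) : i ≠ j := by
  rintro rfl; simp only [Far] at h; omega

theorem Adjacent.not_eq {i j : Fin m} (h : Adjacent i j) : i ≠ j := by
  rintro rfl; simp only [Adjacent] at h; omega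

theorem Far.not_adjacent {i j : Fin m} (h : Far i j) : ¬ Adjacent i j := by
  simp only [Far, Adjacent] at *; omega

theorem LcmFactor.of_far {i j : Fin m} {A B : PosBraid (m + 1)} (h : LcmFactor i A j B)
    (hij : Far i j) : ∃ C, A = gen j * C ∧ B = gen i * C := by
  rcases h with ⟨h, -⟩ | ⟨-, h⟩ | ⟨h, -⟩
  · exact absurd h hij.not_eq
  · exact h
  · exact absurd h hij.not_adjacent

theorem LcmFactor.of_adjacent {i j : Fin m} {A B : PosBraid (m + 1)} (h : LcmFactor i A j B)
    (hij : Adjacent i j) : ∃ C, A = gen j * (gen i * C) ∧ B = gen i * (gen j * C) := by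
  rcases h with ⟨h, -⟩ | ⟨h, -⟩ | ⟨-, h⟩
  · exact absurd h hij.not_eq
  · exact absurd hij h.not_adjacent
  · exact h

theorem LcmFactor.of_eq {i : Fin m} {A B : PosBraid (m + 1)} (h : LcmFactor i A i B) : A = B := by
  rcases h with ⟨-, h⟩ | ⟨h, -⟩ | ⟨h, -⟩
  · exact h
  · exact absurd rfl h.not_eq
  · exact absurd rfl h.not_eq

/-- The mixed case of transitivity, isolated because it occurs twice up to symmetry. The hypothesis
`hK` is the factorization property for shorter cofactors; it is applied repeatedly to peel off
letters until both sides show the lcm of `σ_i` and `σ_j`. -/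
theorem LcmFactor.trans_far_adjacent {N : ℕ}
    (hK : ∀ (i j : Fin m) (A B : PosBraid (m + 1)), len A < N → gen i * A = gen j * B →
      LcmFactor i A j B)
    {i j k : Fin m} {C C' : PosBraid (m + 1)} (hik : Far i k) (hkj : Adjacent k j)
    (hlen : len C < N) (h : gen i * C = gen j * (gen k * C')) :
    LcmFactor i (gen k * C) j (gen k * (gen j * C')) := by
  have hl := congrArg len h
  simp only [len_mul, len_gen] at hl
  rcases hK _ _ _ _ hlen h with ⟨rfl, -⟩ | ⟨hij, F, rfl, hF⟩ | ⟨hij, F, rfl, hF⟩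
  · exact absurd hkj hik.symm.not_adjacent
  · obtain ⟨G, rfl, rfl⟩ := (hK _ _ _ _ (by omega) hF).of_far hik.symm
    refine Or.inr (Or.inl ⟨hij, gen k * (gen j * G), ?_, ?_⟩)
    · rw [gen_braid' hkj]
    · rw [gen_comm' hij.symm, gen_comm' hik.symm]
  · obtain ⟨G, rfl, hG⟩ := (hK _ _ _ _ (by omega) hF).of_far hik.symm
    simp only [len_mul, len_gen] at hlen
    obtain ⟨H, rfl, rfl⟩ := (hK _ _ _ _ (by omega) hG).of_adjacent hkj.symm
    refine Or.inr (Or.inr ⟨hij, gen k * (gen j * (gen i * H)), ?_, ?_⟩)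
    · rw [gen_comm' hik, gen_braid' hkj, gen_braid' hij.symm, gen_comm' hik.symm]
    · rw [gen_braid' hij.symm, gen_comm' hik.symm, gen_comm' hik (H), gen_braid' hkj]

/-- Garside's transitivity step: an equality through a middle word with first letter `k` is resolved
by comparing the two factorizations of `D`. Their common tails are shorter than `N`, so `hK` applies
to them. -/
theorem LcmFactor.trans_of_lt {N : ℕ}
    (hK : ∀ (i j : Fin m) (A B : PosBraid (m + 1)), len A < N → gen i * A = gen j * B →
      LcmFactor i A j B)
    {i j k : Fin m} {A B D : PosBraid (m + 1)} (hN : len D ≤ N)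
    (h1 : LcmFactor i A k D) (h2 : LcmFactor k D j B) : LcmFactor i A j B := by
  rcases h1 with ⟨rfl, rfl⟩ | ⟨hik, C, rfl, rfl⟩ | ⟨hik, C, rfl, rfl⟩
  · exact h2
  · simp only [len_mul, len_gen] at hN
    rcases h2 with ⟨rfl, rfl⟩ | ⟨hkj, C', h, rfl⟩ | ⟨hkj, C', h, rfl⟩
    · exact Or.inr (Or.inl ⟨hik, C, rfl, rfl⟩)
    · rcases hK _ _ _ _ (by omega) h with ⟨rfl, rfl⟩ | ⟨hij, F, rfl, rfl⟩ | ⟨hij, F, rfl, rfl⟩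
      · exact Or.inl ⟨rfl, rfl⟩
      · exact Or.inr (Or.inl ⟨hij, gen k * F, gen_comm' hkj _, gen_comm' hik.symm _⟩)
      · refine Or.inr (Or.inr ⟨hij, gen k * F, ?_, ?_⟩)
        · rw [gen_comm' hkj, gen_comm' hik.symm]
        · rw [gen_comm' hik.symm, gen_comm' hkj]
    · exact LcmFactor.trans_far_adjacent hK hik hkj (by omega) h
  · simp only [len_mul, len_gen] at hN
    rcases h2 with ⟨rfl, rfl⟩ | ⟨hkj, C', h, rfl⟩ | ⟨hkj, C', h, rfl⟩
    · exact Or.inr (Or.inr ⟨hik, C, rfl, rfl⟩)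
    · have hl := congrArg len h
      simp only [len_mul, len_gen] at hl
      exact (LcmFactor.trans_far_adjacent hK hkj.symm hik.symm (by omega) h.symm).symm
    · have hl := congrArg len h
      simp only [len_mul, len_gen] at hl
      rcases hK _ _ _ _ (by simp only [len_mul, len_gen]; omega) h with
        ⟨rfl, h3⟩ | ⟨hij, E, hE, hE'⟩ | ⟨hij, -⟩
      · rw [(hK _ _ _ _ (by omega) h3).of_eq]
        exact Or.inl ⟨rfl, rfl⟩
      · obtain ⟨F, rfl, rfl⟩ := (hK _ _ _ _ (by omega) hE).of_adjacent hkj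
        obtain ⟨G, rfl, hG⟩ := (hK _ _ _ _ (by omega) hE').of_adjacent hik.symm
        simp only [len_mul, len_gen] at hN
        have hG' := (hK _ _ _ _ (by simp only [len_mul, len_gen]; omega) hG).of_eq
        obtain ⟨H, rfl, rfl⟩ := (hK _ _ _ _ (by omega) hG').of_far hij.symm
        refine Or.inr (Or.inl ⟨hij, gen k * (gen i * (gen j * (gen k * H))), ?_, ?_⟩)
        · rw [gen_comm' hij, gen_braid' hik, gen_braid' hkj, gen_comm' hij]
        · rw [gen_comm' hij.symm, gen_braid' hkj.symm, gen_braid' hik.symm]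
      -- Three letters on a line cannot be pairwise adjacent.
      · simp only [Adjacent] at *
        omega

/-- Induction on the derivation that two words are congruent. Relations preserve length, so the
middle word of a transitivity step is nonempty and has a first letter; in a product the first
letters come from the left factors, unless both of these are empty. -/
theorem lcmFactor_of_rel {N : ℕ}
    (hK : ∀ (i j : Fin m) (A B : PosBraid (m + 1)), len A < N → gen i * A = gen j * B →
      LcmFactor i A j B)
    {u v : FreeMonoid (Fin (m + 1 - 1))} (h : ConGen.Rel (BraidRel (m + 1)) u v) :
    u.length ≤ N + 1 → ∀ (i j : Fin m) (A B : FreeMonoid (Fin (m + 1 - 1))),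
      u = FreeMonoid.of (α := Fin (m + 1 - 1)) i * A →
      v = FreeMonoid.of (α := Fin (m + 1 - 1)) j * B →
      LcmFactor i (PresentedMonoid.mk (BraidRel (m + 1)) A) j
        (PresentedMonoid.mk (BraidRel (m + 1)) B) := by
  have hlen : ∀ {u v : FreeMonoid (Fin (m + 1 - 1))}, ConGen.Rel (BraidRel (m + 1)) u v →
      u.length = v.length := fun {u v} h => by
    have := congrArg (len (m := m)) (PresentedMonoid.mk_eq_mk_iff.2 h)
    rwa [len_mk, len_mk] at this
  induction h with
  | of x y hxy =>
    intro hu i j A B hA hB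
    cases hxy with
    | comm k l hkl =>
      obtain ⟨rfl, rfl⟩ := List.cons.inj hA
      obtain ⟨rfl, rfl⟩ := List.cons.inj hB
      exact Or.inr (Or.inl ⟨Or.inl hkl, 1, (mul_one _).symm, (mul_one _).symm⟩)
    | braid k l hkl =>
      obtain ⟨rfl, rfl⟩ := List.cons.inj hA
      obtain ⟨rfl, rfl⟩ := List.cons.inj hB
      exact Or.inr (Or.inr ⟨Or.inl hkl, 1, by rw [mul_one]; rfl, by rw [mul_one]; rfl⟩)
  | refl x =>
    rintro hu i j A B rfl hB
    obtain ⟨rfl, rfl⟩ := List.cons.inj hB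
    exact Or.inl ⟨rfl, rfl⟩
  | symm h ih =>
    intro hu i j A B hA hB
    exact (ih (by rwa [hlen h]) j i B A hB hA).symm
  | @trans x y z h1 h2 ih1 ih2 =>
    intro hu i j A B hA hB
    have h3 := hlen h1
    cases y using FreeMonoid.casesOn with
    | one =>
      rw [hA, FreeMonoid.length_mul, FreeMonoid.length_of, FreeMonoid.length_one] at h3
      omega
    | of_mul k D =>
      refine LcmFactor.trans_of_lt hK ?_ (ih1 hu i k A D hA rfl) (ih2 (by omega) k j D B rfl hB)
      rw [FreeMonoid.length_mul, FreeMonoid.length_of] at h3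
      rw [len_mk]
      omega
  | @mul w x y z h1 h2 ih1 ih2 =>
    intro hu i j A B hA hB
    have h3 := hlen h1
    rw [FreeMonoid.length_mul] at hu
    cases w using FreeMonoid.casesOn with
    | one =>
      obtain rfl : x = 1 := FreeMonoid.length_eq_zero.1 (by rw [← h3, FreeMonoid.length_one])
      rw [one_mul] at hA hB
      exact ih2 (by omega) i j A B hA hB
    | of_mul k D =>
      cases x using FreeMonoid.casesOn with
      | one =>
        rw [FreeMonoid.length_mul, FreeMonoid.length_of, FreeMonoid.length_one] at h3
        omega
      | of_mul l E =>
        obtain ⟨rfl, rfl⟩ := List.cons.inj hA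
        obtain ⟨rfl, rfl⟩ := List.cons.inj hB
        have h4 := (ih1 (by omega) k l D E rfl rfl).mul_right
          (PresentedMonoid.mk (BraidRel (m + 1)) y)
        have h5 : PresentedMonoid.mk (BraidRel (m + 1)) y = PresentedMonoid.mk (BraidRel (m + 1)) z :=
          PresentedMonoid.mk_eq_mk_iff.2 h2
        nth_rw 2 [h5] at h4
        exact h4

theorem lcmFactor_of_mul_eq {i j : Fin m} {A B : PosBraid (m + 1)} (h : gen i * A = gen j * B) :
    LcmFactor i A j B := by
  suffices H : ∀ N : ℕ, ∀ (i j : Fin m) (A B : PosBraid (m + 1)), len A < N →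
      gen i * A = gen j * B → LcmFactor i A j B from H _ i j A B (Nat.lt_succ_self _) h
  intro N
  induction N with
  | zero => intro i j A B h; omega
  | succ N ih =>
    intro i j A B hA h
    obtain ⟨u, rfl⟩ := PresentedMonoid.surjective_mk A
    obtain ⟨v, rfl⟩ := PresentedMonoid.surjective_mk B
    rw [len_mk] at hA
    refine lcmFactor_of_rel (N := N) ih ((PresentedMonoid.mk_eq_mk_iff
      (x := FreeMonoid.of (α := Fin (m + 1 - 1)) i * u)
      (y := FreeMonoid.of (α := Fin (m + 1 - 1)) j * v)).1 h) ?_ i j u v rfl rfl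
    · rw [FreeMonoid.length_mul, FreeMonoid.length_of]; omega

theorem gen_mul_cancel {i : Fin m} {A B : PosBraid (m + 1)} (h : gen i * A = gen i * B) : A = B :=
  (lcmFactor_of_mul_eq h).of_eq

end Garside

/-! ### Simple braids as reduced braids, and the greatest common divisor with the fundamental braid.
-/

section SimpleBraids

open Equiv

variable {m : ℕ}

theorem posBraid_induction {P : PosBraid (m + 1) → Prop} (one : P 1)
    (mul_gen : ∀ x i, P x → P (x * gen i)) (x : PosBraid (m + 1)) : P x := by
  obtain ⟨w, rfl⟩ := PresentedMonoid.surjective_mk x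
  induction w using List.reverseRecOn with
  | nil => exact one
  | append_singleton w i ih => exact mul_gen _ i ih

theorem exists_eq_gen_mul {x : PosBraid (m + 1)} (hx : x ≠ 1) : ∃ i y, x = gen i * y := by
  obtain ⟨w, rfl⟩ := PresentedMonoid.surjective_mk x
  cases w using FreeMonoid.casesOn with
  | one => exact absurd (map_one _) hx
  | of_mul i w => exact ⟨i, PresentedMonoid.mk _ w, map_mul _ _ _⟩

theorem eq_one_of_len {x : PosBraid (m + 1)} (hx : len x = 0) : x = 1 := by
  by_contra h
  obtain ⟨i, y, rfl⟩ := exists_eq_gen_mul h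
  rw [len_mul, len_gen] at hx
  omega

theorem posBraid_mul_left_cancel {a x y : PosBraid (m + 1)} (h : a * x = a * y) : x = y := by
  induction a using posBraid_induction generalizing x y with
  | one => simpa using h
  | mul_gen a i ih =>
    rw [mul_assoc, mul_assoc] at h
    exact gen_mul_cancel (ih h)

theorem posBraid_dvd_antisymm {x y : PosBraid (m + 1)} (h1 : x ∣ y) (h2 : y ∣ x) : x = y := by
  obtain ⟨c, rfl⟩ := h1
  obtain ⟨d, hd⟩ := h2
  have h := congrArg len hd
  simp only [len_mul] at h
  rw [eq_one_of_len (x := c) (by omega), mul_one]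

/-- The permutation underlying a positive braid. -/
def permHom (m : ℕ) : PosBraid (m + 1) →* Perm (Fin (m + 1)) :=
  PresentedMonoid.lift (fun i : Fin (m + 1 - 1) => adjSwap (m := m) i) (by
    intro a b h
    cases h with
    | comm i j h => simpa using adjSwap_comm (m := m) h
    | braid i j h => simpa using adjSwap_braid (m := m) h)

@[simp] theorem permHom_gen (i : Fin m) : permHom m (gen i) = adjSwap i := rfl

theorem invNum_mul_permHom_le (w : Perm (Fin (m + 1))) (y : PosBraid (m + 1)) :
    invNum (w * permHom m y) ≤ invNum w + len y := by
  induction y using posBraid_induction with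
  | one => simp
  | mul_gen y i ih =>
    rw [map_mul, ← mul_assoc, permHom_gen, len_mul, len_gen]
    have := invNum_mul_adjSwap_le (w * permHom m y) i
    omega

theorem invNum_permHom_mul_le (w : Perm (Fin (m + 1))) (y : PosBraid (m + 1)) :
    invNum (permHom m y * w) ≤ len y + invNum w := by
  induction y using posBraid_induction generalizing w with
  | one => simp
  | mul_gen y i ih =>
    rw [map_mul, mul_assoc, permHom_gen, len_mul, len_gen]
    have h1 := invNum_mul_adjSwap_le w⁻¹ i
    rw [← invNum_inv, mul_inv_rev, inv_inv, adjSwap_inv, invNum_inv] at h1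
    have := ih (adjSwap i * w)
    omega

theorem invNum_permHom_le (x : PosBraid (m + 1)) : invNum (permHom m x) ≤ len x := by
  simpa using invNum_mul_permHom_le 1 x

/-- A positive braid is reduced if its length is the number of inversions of its permutation. -/
def Reduced (x : PosBraid (m + 1)) : Prop := len x = invNum (permHom m x)

theorem reduced_one : Reduced (1 : PosBraid (m + 1)) := by
  simp [Reduced]

theorem Reduced.of_mul_left {x y : PosBraid (m + 1)} (h : Reduced (x * y)) : Reduced x := by
  have h1 := invNum_mul_permHom_le (permHom m x) y
  have h2 := invNum_permHom_le x
  rw [Reduced, map_mul, len_mul] at h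
  rw [Reduced]
  omega

theorem Reduced.of_mul_right {x y : PosBraid (m + 1)} (h : Reduced (x * y)) : Reduced y := by
  have h1 := invNum_permHom_mul_le (permHom m y) x
  have h2 := invNum_permHom_le y
  rw [Reduced, map_mul, len_mul] at h
  rw [Reduced]
  omega

theorem Reduced.of_dvd {x y : PosBraid (m + 1)} (h : Reduced y) (hxy : x ∣ y) : Reduced x := by
  obtain ⟨c, rfl⟩ := hxy
  exact h.of_mul_left

theorem Reduced.mul_gen_iff {x : PosBraid (m + 1)} (h : Reduced x) (i : Fin m) :
    Reduced (x * gen i) ↔ permHom m x i.castSucc < permHom m x i.succ := by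
  rw [Reduced] at h
  rw [Reduced, len_mul, len_gen, map_mul, permHom_gen, ← invNum_mul_adjSwap_lt_iff, h, eq_comm]

theorem exists_reduced (w : Perm (Fin (m + 1))) : ∃ x, Reduced x ∧ permHom m x = w := by
  induction hN : invNum w using Nat.strong_induction_on generalizing w with
  | _ N ih =>
    by_cases hw : w = 1
    · exact ⟨1, reduced_one, by rw [map_one, hw]⟩
    · obtain ⟨i, hi⟩ := exists_descent hw
      have h1 := invNum_mul_adjSwap_of_gt hi
      obtain ⟨x, hx, hxw⟩ := ih _ (by omega) (w * adjSwap i) rfl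
      refine ⟨x * gen i, (hx.mul_gen_iff i).2 ?_, ?_⟩
      · simpa [hxw] using hi
      · rw [map_mul, permHom_gen, hxw, mul_assoc, adjSwap_mul_self, mul_one]

theorem Far.adjSwap_castSucc {i j : Fin m} (h : Far i j) :
    adjSwap i j.castSucc = j.castSucc := by
  apply adjSwap_of_ne <;> simp only [Far, Fin.val_castSucc] at * <;> omega

theorem Far.adjSwap_succ {i j : Fin m} (h : Far i j) :
    adjSwap i j.succ = j.succ := by
  apply adjSwap_of_ne <;> simp only [Far, Fin.val_succ] at * <;> omega

theorem adjSwap_values {i j : Fin m} (h : (i : ℕ) + 1 = j) :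
    j.castSucc = i.succ ∧ adjSwap i j.succ = j.succ ∧ adjSwap j i.castSucc = i.castSucc ∧
      adjSwap j i.succ = j.succ := by
  have h1 : j.castSucc = i.succ := by ext; simp [h]
  refine ⟨h1, ?_, ?_, ?_⟩
  · apply adjSwap_of_ne <;> simp only [Fin.val_succ] at * <;> omega
  · apply adjSwap_of_ne <;> simp only [Fin.val_castSucc] at * <;> omega
  · rw [← h1, adjSwap_castSucc]

theorem Adjacent.lt_of_descents {i j : Fin m} (h : Adjacent i j) {w : Perm (Fin (m + 1))}
    (hi : w i.succ < w i.castSucc) (hj : w j.succ < w j.castSucc) :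
    (w * adjSwap i * adjSwap j * adjSwap i) i.castSucc <
        (w * adjSwap i * adjSwap j * adjSwap i) i.succ ∧
      (w * adjSwap i * adjSwap j) j.castSucc < (w * adjSwap i * adjSwap j) j.succ := by
  rcases h with h | h <;> obtain ⟨h1, h2, h3, h4⟩ := adjSwap_values h <;>
    simp only [Perm.mul_apply, adjSwap_castSucc, adjSwap_succ, h1, h2, h3, h4] at * <;>
    exact ⟨by assumption, by first | exact hi.trans hj | exact hj.trans hi⟩

theorem Adjacent.lt_of_ascents {i j : Fin m} (h : Adjacent i j) {w : Perm (Fin (m + 1))}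
    (hi : w i.castSucc < w i.succ) (hj : w j.castSucc < w j.succ) :
    (w * adjSwap i) j.castSucc < (w * adjSwap i) j.succ ∧
      (w * adjSwap i * adjSwap j) i.castSucc < (w * adjSwap i * adjSwap j) i.succ := by
  rcases h with h | h <;> obtain ⟨h1, h2, h3, h4⟩ := adjSwap_values h <;>
    simp only [Perm.mul_apply, adjSwap_castSucc, adjSwap_succ, h1, h2, h3, h4] at * <;>
    exact ⟨by first | exact hi.trans hj | exact hj.trans hi, by assumption⟩

/-- Matsumoto's theorem: a reduced braid is determined by its permutation. -/
theorem Reduced.ext {x y : PosBraid (m + 1)} (hx : Reduced x) (hy : Reduced y)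
    (h : permHom m x = permHom m y) : x = y := by
  induction hN : len x using Nat.strong_induction_on generalizing x y with
  | _ N ih =>
    have hlen : len x = len y := by rw [hx, hy, h]
    induction x using posBraid_induction with
    | one => exact (eq_one_of_len (by rw [← hlen, len_one])).symm
    | mul_gen x i _ =>
      induction y using posBraid_induction with
      | one => exact eq_one_of_len (by rw [hlen, len_one])
      | mul_gen y j _ =>
        simp only [len_mul, len_gen] at hN hlen
        have hx' := hx.of_mul_left
        have hy' := hy.of_mul_left
        have hi := (hx'.mul_gen_iff i).1 hx
        have hj := (hy'.mul_gen_iff j).1 hy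
        simp only [map_mul, permHom_gen] at h
        -- The common permutation of both braids. Both last letters `i` and `j` are descents of it,
        -- so a reduced braid `r` ending before the lcm of `σ_i` and `σ_j` exists, and the induction
        -- hypothesis identifies `x` and `y` with extensions of `r`.
        obtain ⟨w, hw⟩ : ∃ w, w = permHom m x * adjSwap i := ⟨_, rfl⟩
        have hwx : permHom m x = w * adjSwap i := by
          rw [hw, mul_assoc, adjSwap_mul_self, mul_one]
        have hwy : permHom m y = w * adjSwap j := by
          rw [hw, h, mul_assoc, adjSwap_mul_self, mul_one]
        rw [hwx] at hi
        rw [hwy] at hj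
        simp only [Perm.mul_apply, adjSwap_castSucc, adjSwap_succ] at hi hj
        rcases eq_or_far_or_adjacent i j with rfl | hij | hij
        · rw [ih (len x) (by omega) hx' hy' (by rw [hwx, hwy]) rfl]
        · obtain ⟨r, hr, hrw⟩ := exists_reduced (w * adjSwap i * adjSwap j)
          have hc : adjSwap i * adjSwap j = adjSwap j * adjSwap i := by
            rw [← permHom_gen, ← permHom_gen, ← map_mul, gen_comm hij, map_mul]
          have h1 : x = r * gen j := by
            refine ih (len x) (by omega) hx' ((hr.mul_gen_iff j).2 ?_) ?_ rfl
            · simpa [hrw, hij.adjSwap_castSucc, hij.adjSwap_succ] using hj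
            · rw [map_mul, hrw, permHom_gen, hwx, mul_assoc (w * _), adjSwap_mul_self, mul_one]
          have h2 : y = r * gen i := by
            rw [mul_assoc, hc, ← mul_assoc] at hrw
            refine ih (len y) (by omega) hy' ((hr.mul_gen_iff i).2 ?_) ?_ rfl
            · simpa [hrw, hij.symm.adjSwap_castSucc, hij.symm.adjSwap_succ] using hi
            · rw [map_mul, hrw, permHom_gen, hwy, mul_assoc (w * _), adjSwap_mul_self, mul_one]
          rw [h1, h2, mul_assoc, mul_assoc, gen_comm hij]
        · have aux : ∀ {i j : Fin m} {x : PosBraid (m + 1)}, Adjacent i j → Reduced x →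
              len x < N → permHom m x = w * adjSwap i → w i.succ < w i.castSucc →
              w j.succ < w j.castSucc → ∀ r, Reduced r →
              permHom m r = w * adjSwap i * adjSwap j * adjSwap i →
              x = r * gen i * gen j := by
            intro i j x hij hx hN hxw hi hj r hr hrw
            obtain ⟨h1, h2⟩ := hij.lt_of_descents hi hj
            have h3 : Reduced (r * gen i) := (hr.mul_gen_iff i).2 (by rwa [hrw])
            have h4 : permHom m (r * gen i) = w * adjSwap i * adjSwap j := by
              rw [map_mul, hrw, permHom_gen, mul_assoc (_ * _), adjSwap_mul_self, mul_one]
            refine ih (len x) hN hx ((h3.mul_gen_iff j).2 (by rwa [h4])) ?_ rfl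
            rw [map_mul, h4, permHom_gen, mul_assoc (w * _), adjSwap_mul_self, mul_one, hxw]
          obtain ⟨r, hr, hrw⟩ := exists_reduced (w * adjSwap i * adjSwap j * adjSwap i)
          have hc : w * adjSwap i * adjSwap j * adjSwap i =
              w * adjSwap j * adjSwap i * adjSwap j := by
            have := congrArg (permHom m) (gen_braid hij)
            simp only [map_mul, permHom_gen] at this
            rw [mul_assoc, mul_assoc, ← mul_assoc (adjSwap i), this]
            simp only [mul_assoc]
          rw [aux hij hx' (by omega) hwx hi hj r hr hrw,
            aux hij.symm hy' (by omega) hwy hj hi r hr (hrw.trans hc)]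
          have := congrArg (r * ·) (gen_braid hij)
          simpa only [mul_assoc] using this

/-- The permutation of a braid word. -/
def wordPerm (m : ℕ) : FreeMonoid (Fin m) →* Perm (Fin (m + 1)) := FreeMonoid.lift adjSwap

theorem wordPerm_map_castSucc (w : FreeMonoid (Fin m)) :
    (∀ p : Fin (m + 1), wordPerm (m + 1) (FreeMonoid.map Fin.castSucc w) p.castSucc =
      (wordPerm m w p).castSucc) ∧
    wordPerm (m + 1) (FreeMonoid.map Fin.castSucc w) (Fin.last (m + 1)) = Fin.last (m + 1) := by
  induction w using FreeMonoid.inductionOn' with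
  | one => simp
  | of_mul i w ih =>
    have h1 : ∀ p : Fin (m + 1), adjSwap i.castSucc p.castSucc = (adjSwap i p).castSucc := by
      intro p
      ext
      simp [adjSwap_val]
    have h2 : adjSwap i.castSucc (Fin.last (m + 1)) = Fin.last (m + 1) := by
      apply adjSwap_of_ne <;> simp <;> omega
    simp only [map_mul, Perm.mul_apply, FreeMonoid.map_of, ih]
    simp [wordPerm, h1, h2]

/-- The word `σ_1 ⋯ σ_m` acts as the cycle `p ↦ p + 1`; following the reversal of the first `m + 1`
points by the next such cycle gives the reversal of all `m + 2`. -/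
theorem wordPerm_finRange (m : ℕ) (p : Fin (m + 1)) :
    (wordPerm m (FreeMonoid.ofList (List.finRange m)) p : ℕ) =
      if (p : ℕ) = m then 0 else (p : ℕ) + 1 := by
  induction m with
  | zero =>
    have : p = 0 := Fin.ext (by omega)
    simp [this]
  | succ m ih =>
    rw [List.finRange_succ_last, FreeMonoid.ofList_append, FreeMonoid.ofList_map, map_mul,
      FreeMonoid.ofList_singleton, Perm.mul_apply]
    have hl : wordPerm (m + 1) (FreeMonoid.of (Fin.last m)) = adjSwap (Fin.last m) := rfl
    rw [hl]
    obtain ⟨h1, h2⟩ := wordPerm_map_castSucc (FreeMonoid.ofList (List.finRange m))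
    refine Fin.lastCases ?_ (fun p => ?_) p
    · rw [← Fin.succ_last, adjSwap_succ, h1, Fin.val_castSucc, ih]
      simp
    · by_cases hp : p = Fin.last m
      · subst hp
        rw [adjSwap_castSucc, Fin.succ_last, h2]
        simp
      · have hp' : (p : ℕ) ≠ m := fun h => hp (Fin.ext h)
        rw [adjSwap_of_ne (by simpa using hp') (by simp; omega), h1, Fin.val_castSucc, ih,
          if_neg hp', Fin.val_castSucc, if_neg (by omega)]

theorem wordPerm_deltaWord (m : ℕ) : wordPerm m (deltaWord m) = Fin.revPerm := by
  induction m with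
  | zero => exact Equiv.ext fun p => Fin.ext (by omega)
  | succ m ih =>
    ext p
    obtain ⟨h1, h2⟩ := wordPerm_map_castSucc (deltaWord m)
    rw [deltaWord, map_mul, Perm.mul_apply, wordPerm_finRange]
    refine Fin.lastCases ?_ (fun p => ?_) p
    · rw [h2]
      simp
    · rw [h1, ih]
      simp only [Fin.val_castSucc, Fin.revPerm_apply, Fin.val_rev]
      split_ifs <;> omega

theorem length_deltaWord (m : ℕ) : (deltaWord m).length = (m + 1) * m / 2 := by
  induction m with
  | zero => rfl
  | succ m ih =>
    have h1 : (FreeMonoid.map Fin.castSucc (deltaWord m)).length = (deltaWord m).length :=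
      List.length_map _
    have h2 : (FreeMonoid.ofList (List.finRange (m + 1))).length = m + 1 := List.length_finRange
    rw [deltaWord, FreeMonoid.length_mul, h1, h2, ih]
    have : (m + 1 + 1) * (m + 1) = (m + 1) * m + (m + 1) * 2 := by ring
    rw [this, Nat.add_mul_div_right _ _ (by norm_num), add_comm]

theorem permHom_deltaBraid (m : ℕ) : permHom m (deltaBraid (m + 1)) = Fin.revPerm :=
  wordPerm_deltaWord m

theorem reduced_deltaBraid (m : ℕ) : Reduced (deltaBraid (m + 1)) := by
  rw [Reduced, permHom_deltaBraid, invNum_revPerm]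
  exact (len_mk _).trans (length_deltaWord m)

/-- Extend `x` on the right by letters as long as it stays reduced; this stops because inversions
are bounded. At the end every position is a descent, so the permutation is the reversal and
Matsumoto's theorem gives `Δ`. -/
theorem Reduced.dvd_deltaBraid {x : PosBraid (m + 1)} (hx : Reduced x) :
    x ∣ deltaBraid (m + 1) := by
  induction hN : (m + 1) * (m + 1) - len x using Nat.strong_induction_on generalizing x with
  | _ N ih =>
    by_cases h : ∃ i, Reduced (x * gen i)
    · obtain ⟨i, hi⟩ := h
      have hb := invNum_le (permHom m (x * gen i))
      rw [← hi, len_mul, len_gen] at hb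
      have := ih _ (by rw [len_mul, len_gen]; omega) hi rfl
      exact (Dvd.intro _ rfl).trans this
    · push Not at h
      have : x = deltaBraid (m + 1) := by
        refine hx.ext (reduced_deltaBraid m) ?_
        rw [permHom_deltaBraid]
        refine eq_revPerm_of_descents fun i => ?_
        have h1 := h i
        rw [hx.mul_gen_iff, not_lt] at h1
        exact lt_of_le_of_ne h1 (apply_castSucc_ne_succ _ _).symm
      rw [this]

theorem dvd_deltaBraid_iff {x : PosBraid (m + 1)} : x ∣ deltaBraid (m + 1) ↔ Reduced x :=
  ⟨(reduced_deltaBraid m).of_dvd, Reduced.dvd_deltaBraid⟩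

/-- Local confluence: after cancelling `a`, Garside's lemma puts the lcm of the two letters in front
of the rest of `z`, and it stays reduced because both letters are ascents of `a`. -/
theorem exists_common_multiple {z a : PosBraid (m + 1)} {i j : Fin m}
    (hi : Reduced (a * gen i)) (hiz : a * gen i ∣ z) (hj : Reduced (a * gen j))
    (hjz : a * gen j ∣ z) :
    ∃ e, Reduced e ∧ e ∣ z ∧ a * gen i ∣ e ∧ a * gen j ∣ e := by
  have ha := hi.of_mul_left
  obtain ⟨A, rfl⟩ := hiz
  obtain ⟨B, hB⟩ := hjz
  rw [mul_assoc, mul_assoc] at hB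
  have hi' := (ha.mul_gen_iff i).1 hi
  have hj' := (ha.mul_gen_iff j).1 hj
  rcases lcmFactor_of_mul_eq (posBraid_mul_left_cancel hB) with ⟨rfl, rfl⟩ |
    ⟨hij, C, rfl, rfl⟩ | ⟨hij, C, rfl, rfl⟩
  · exact ⟨_, hi, Dvd.intro _ rfl, dvd_rfl, dvd_rfl⟩
  · refine ⟨a * gen i * gen j, (hi.mul_gen_iff j).2 ?_, ⟨C, by simp only [mul_assoc]⟩,
      Dvd.intro _ rfl, ⟨gen i, ?_⟩⟩
    · simpa [hij.adjSwap_castSucc, hij.adjSwap_succ] using hj'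
    · rw [mul_assoc, gen_comm hij, mul_assoc]
  · obtain ⟨h1, h2⟩ := hij.lt_of_ascents hi' hj'
    have h3 : Reduced (a * gen i * gen j) := (hi.mul_gen_iff j).2 (by simpa using h1)
    refine ⟨a * gen i * gen j * gen i, (h3.mul_gen_iff i).2 (by simpa using h2),
      ⟨C, by simp only [mul_assoc]⟩, ⟨gen j * gen i, by simp only [mul_assoc]⟩,
      ⟨gen i * gen j, ?_⟩⟩
    have := congrArg (a * ·) (gen_braid hij)
    simpa only [mul_assoc] using this

/-- A reduced left divisor of `z` that no letter extends to a longer one. -/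
def TerminalDivisor (z t : PosBraid (m + 1)) : Prop :=
  Reduced t ∧ t ∣ z ∧ ∀ i, Reduced (t * gen i) → ¬ t * gen i ∣ z

theorem len_le_of_dvd {x y : PosBraid (m + 1)} (h : x ∣ y) : len x ≤ len y := by
  obtain ⟨c, rfl⟩ := h
  rw [len_mul]
  omega

theorem exists_terminalDivisor {z a : PosBraid (m + 1)} (ha : Reduced a) (haz : a ∣ z) :
    ∃ t, a ∣ t ∧ TerminalDivisor z t := by
  induction hN : len z - len a using Nat.strong_induction_on generalizing a with
  | _ N ih =>
    by_cases h : ∃ i, Reduced (a * gen i) ∧ a * gen i ∣ z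
    · obtain ⟨i, hi, hiz⟩ := h
      have hl := len_le_of_dvd hiz
      rw [len_mul, len_gen] at hl
      obtain ⟨t, h1, h2⟩ := ih _ (by rw [len_mul, len_gen]; omega) hi hiz rfl
      exact ⟨t, (Dvd.intro _ rfl).trans h1, h2⟩
    · push Not at h
      exact ⟨a, dvd_rfl, ha, haz, h⟩

theorem TerminalDivisor.eq_of_dvd {z t a : PosBraid (m + 1)} (ht : TerminalDivisor z t)
    (ha : Reduced a) (haz : a ∣ z) (hta : t ∣ a) : a = t := by
  obtain ⟨c, rfl⟩ := hta
  by_cases hc : c = 1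
  · rw [hc, mul_one]
  · obtain ⟨i, y, rfl⟩ := exists_eq_gen_mul hc
    rw [← mul_assoc] at ha haz
    exact absurd (dvd_of_mul_right_dvd haz) (ht.2.2 i ha.of_mul_left)

/-- The diamond argument: two different first extensions of `a` have a common reduced multiple
dividing `z`, and a terminal divisor `s` above it equals both `t` and `t'` by induction. So greedily
extending any reduced divisor ends at the same place, which makes that place the gcd. -/
theorem TerminalDivisor.unique {z a t t' : PosBraid (m + 1)} (ha : a ∣ t) (ha' : a ∣ t')
    (ht : TerminalDivisor z t) (ht' : TerminalDivisor z t') : t = t' := by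
  induction hN : len z - len a using Nat.strong_induction_on generalizing a t t' with
  | _ N ih =>
    obtain ⟨c, rfl⟩ := ha
    obtain ⟨c', rfl⟩ := ha'
    by_cases hc : c = 1
    · subst hc
      rw [mul_one] at ht ⊢
      exact (ht.eq_of_dvd ht'.1 ht'.2.1 (Dvd.intro _ rfl)).symm
    by_cases hc' : c' = 1
    · subst hc'
      rw [mul_one] at ht' ⊢
      exact ht'.eq_of_dvd ht.1 ht.2.1 (Dvd.intro _ rfl)
    obtain ⟨i, y, rfl⟩ := exists_eq_gen_mul hc
    obtain ⟨j, y', rfl⟩ := exists_eq_gen_mul hc'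
    rw [← mul_assoc] at ht ht' ⊢
    rw [← mul_assoc]
    have hiz := dvd_of_mul_right_dvd ht.2.1
    have hjz := dvd_of_mul_right_dvd ht'.2.1
    obtain ⟨e, he, hez, hie, hje⟩ :=
      exists_common_multiple ht.1.of_mul_left hiz ht'.1.of_mul_left hjz
    obtain ⟨s, hes, hs⟩ := exists_terminalDivisor he hez
    have hl := len_le_of_dvd hiz
    rw [len_mul, len_gen] at hl
    rw [ih _ (by rw [len_mul, len_gen]; omega) (Dvd.intro _ rfl) (hie.trans hes) ht hs rfl,
      ih _ (by rw [len_mul, len_gen]; omega) (Dvd.intro _ rfl) (hje.trans hes) ht' hs rfl]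

theorem TerminalDivisor.dvd {z t c : PosBraid (m + 1)} (ht : TerminalDivisor z t)
    (hc : Reduced c) (hcz : c ∣ z) : c ∣ t := by
  obtain ⟨t', h1, h2⟩ := exists_terminalDivisor hc hcz
  rwa [ht.unique (one_dvd _) (one_dvd _) h2]

theorem isLeftGcd_deltaBraid_iff {z t : PosBraid (m + 1)} :
    IsLeftGcd t (deltaBraid (m + 1)) z ↔ TerminalDivisor z t := by
  constructor
  · rintro ⟨h1, h2, h3⟩
    refine ⟨dvd_deltaBraid_iff.1 h1, h2, fun i hi hiz => ?_⟩
    have := len_le_of_dvd (h3 _ (dvd_deltaBraid_iff.2 hi) hiz)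
    rw [len_mul, len_gen] at this
    omega
  · intro h
    exact ⟨dvd_deltaBraid_iff.2 h.1, h.2.1, fun c hc hcz => h.dvd (dvd_deltaBraid_iff.1 hc) hcz⟩

theorem posBraid_mul_dvd_mul_iff {a x y : PosBraid (m + 1)} : a * x ∣ a * y ↔ x ∣ y := by
  constructor
  · rintro ⟨c, hc⟩
    rw [mul_assoc] at hc
    exact ⟨c, posBraid_mul_left_cancel hc⟩
  · rintro ⟨c, rfl⟩
    exact ⟨c, by rw [mul_assoc]⟩

theorem isLeftGcd_deltaBraid_mul_iff {x z : PosBraid (m + 1)} :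
    IsLeftGcd x (deltaBraid (m + 1)) (x * z) ↔
      Reduced x ∧ ∀ i, gen i ∣ z → ¬ Reduced (x * gen i) := by
  rw [isLeftGcd_deltaBraid_iff, TerminalDivisor]
  simp only [posBraid_mul_dvd_mul_iff, dvd_mul_right, true_and]
  exact and_congr_right fun _ => forall_congr' fun i => imp_not_comm

end SimpleBraids

/-! ### Normal sequences as paths, counted by powers of the incidence matrix. -/

section Counting

variable {m : ℕ}

theorem isNormal_singleton {n : ℕ} {x : PosBraid n} : IsNormal [x] ↔ x ∣ deltaBraid n := by
  simp only [IsNormal, List.prod_nil, mul_one, and_true]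
  exact ⟨fun h => h.1, fun h => ⟨h, dvd_rfl, fun c _ h => h⟩⟩

theorem reduced_gen (i : Fin m) : Reduced (gen i) := by
  have := (reduced_one.mul_gen_iff i).2 (by simp [Fin.lt_def])
  rwa [one_mul] at this

/-- Normality is local. Only the first letters of the tail product matter for `x`, and when the tail
is normal these are the first letters of `y`, since a letter is simple and `y` is the gcd. -/
theorem isNormal_cons_cons {x y : PosBraid (m + 1)} {l : List (PosBraid (m + 1))} :
    IsNormal (x :: y :: l) ↔ IsNormal [x, y] ∧ IsNormal (y :: l) := by
  have h1 : IsNormal (x :: y :: l) ↔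
    IsLeftGcd x (deltaBraid (m + 1)) (x * (y * l.prod)) ∧ IsNormal (y :: l) := by
      rw [IsNormal, List.prod_cons]
  have h2 : IsNormal [x, y] ↔
    IsLeftGcd x (deltaBraid (m + 1)) (x * y) ∧ y ∣ deltaBraid (m + 1) := by
      rw [IsNormal, List.prod_singleton, isNormal_singleton]
  have h3 : IsNormal (y :: l) → ∀ i, gen i ∣ y * l.prod ↔ gen i ∣ y := fun h i =>
    ⟨fun hi => h.1.2.2 _ (reduced_gen i).dvd_deltaBraid hi, fun hi => hi.mul_right _⟩
  rw [h1, h2, isLeftGcd_deltaBraid_mul_iff, isLeftGcd_deltaBraid_mul_iff]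
  constructor
  · rintro ⟨hx, hy⟩
    simp only [h3 hy] at hx
    exact ⟨⟨hx, hy.1.1⟩, hy⟩
  · rintro ⟨⟨hx, -⟩, hy⟩
    simp only [h3 hy]
    exact ⟨hx, hy⟩

theorem isNormal_append_pair {x y : PosBraid (m + 1)} {l : List (PosBraid (m + 1))} :
    IsNormal (l ++ [x, y]) ↔ IsNormal (l ++ [x]) ∧ IsNormal [x, y] := by
  induction l with
  | nil =>
    exact ⟨fun h => ⟨isNormal_singleton.2 (h.dvd_delta x (by simp)), h⟩, fun h => h.2⟩
  | cons a l ih =>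
    cases l with
    | nil =>
      simp only [List.nil_append, List.cons_append]
      rw [isNormal_cons_cons]
    | cons b l =>
      simp only [List.cons_append] at ih ⊢
      rw [isNormal_cons_cons, ih, isNormal_cons_cons (l := l ++ [x]), and_assoc]

theorem isNormal_append_one {n : ℕ} {l : List (PosBraid n)} :
    IsNormal (l ++ [1]) ↔ IsNormal l := by
  induction l with
  | nil => simp [isNormal_singleton, IsNormal]
  | cons a l ih => simp [IsNormal, ih]

theorem isNormal_range_of_trivial {n : ℕ} {s : ℕ → PosBraid n} {d : ℕ}
    (h : ∀ k, d ≤ k → s k = 1) (e : ℕ) :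
    IsNormal ((List.range (d + e)).map s) ↔ IsNormal ((List.range d).map s) := by
  induction e with
  | zero => rfl
  | succ e ih =>
    rw [← add_assoc, List.range_succ, List.map_append, List.map_singleton, h (d + e) (by omega),
      isNormal_append_one, ih]

/-- The head is the gcd of `Δ` with the product, so it is determined by the product; cancel it and
repeat. Equal lengths are needed because trailing factors `1` are allowed. -/
theorem IsNormal.eq_of_prod_eq {l l' : List (PosBraid (m + 1))} (h : IsNormal l)
    (h' : IsNormal l') (hlen : l.length = l'.length) (hprod : l.prod = l'.prod) : l = l' := by
  induction l generalizing l' with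
  | nil => exact (List.length_eq_zero_iff.1 hlen.symm).symm
  | cons a l ih =>
    cases l' with
    | nil => simp at hlen
    | cons b l' =>
      have ha := h.1
      have hb := h'.1
      rw [← List.prod_cons] at ha hb
      rw [hprod] at ha
      obtain rfl := posBraid_dvd_antisymm (hb.2.2 _ ha.1 ha.2.1) (ha.2.2 _ hb.1 hb.2.1)
      rw [List.prod_cons, List.prod_cons] at hprod
      rw [ih h.2 h'.2 (by simpa using hlen) (posBraid_mul_left_cancel hprod)]

/-- The lists of length `d` which followed by `x` are a normal sequence. -/
def normalPrefixes (d : ℕ) (x : PosBraid (m + 1)) : Set (List (PosBraid (m + 1))) :=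
  {l | l.length = d ∧ IsNormal (l ++ [x])}

theorem braidsWithFactor_succ (d : ℕ) (x : SimpleBraid (m + 1)) :
    braidsWithFactor (m + 1) (d + 1) x =
      (fun l => (l ++ [(x : PosBraid (m + 1))]).prod) '' normalPrefixes d (x : PosBraid (m + 1)) := by
  ext z
  constructor
  · rintro ⟨s, ⟨N, hN, hnorm, rfl⟩, hd, hx⟩
    have hL : (List.range d).map s ++ [(x : PosBraid (m + 1))] = (List.range (d + 1)).map s := by
      rw [List.range_succ, List.map_append, List.map_singleton, ← hx, Nat.add_sub_cancel]
    refine ⟨(List.range d).map s, ⟨by simp, ?_⟩, ?_⟩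
    · rw [hL, ← isNormal_range_of_trivial hd N, add_comm (d + 1) N, isNormal_range_of_trivial hN]
      exact hnorm
    · simp only
      rw [hL, ← prod_range_of_trivial hd N, add_comm (d + 1) N, prod_range_of_trivial hN]
  · rintro ⟨l, ⟨hl, hnorm⟩, rfl⟩
    -- The default value `1` extends the list by the trivial factors of an infinite normal form.
    have hL : (List.range (d + 1)).map (fun k => (l ++ [(x : PosBraid (m + 1))]).getD k 1) =
        l ++ [(x : PosBraid (m + 1))] := by
      refine List.ext_getElem (by simp [hl]) fun k h1 h2 => ?_
      rw [List.getElem_map, List.getElem_range, List.getD_eq_getElem _ _ h2]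
    have htriv : ∀ k, d + 1 ≤ k → (l ++ [(x : PosBraid (m + 1))]).getD k 1 = 1 := fun k hk =>
      List.getD_eq_default _ _ (by simp [hl, hk])
    refine ⟨fun k => (l ++ [(x : PosBraid (m + 1))]).getD k 1, ⟨d + 1, htriv, ?_, ?_⟩, htriv, ?_⟩
    · rwa [hL]
    · rw [hL]
    · simp [← hl]

theorem ncard_braidsWithFactor_succ (d : ℕ) (x : SimpleBraid (m + 1)) :
    (braidsWithFactor (m + 1) (d + 1) x).ncard =
      Nat.card (normalPrefixes d (x : PosBraid (m + 1))) := by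
  rw [braidsWithFactor_succ, Nat.card_coe_set_eq]
  refine Set.InjOn.ncard_image fun l hl l' hl' h => ?_
  exact List.append_cancel_right
    (hl.2.eq_of_prod_eq hl'.2 (by simp [hl.1, hl'.1]) h)

theorem normalPrefixes_zero (x : SimpleBraid (m + 1)) :
    normalPrefixes 0 (x : PosBraid (m + 1)) = {[]} := by
  ext l
  simp only [normalPrefixes, Set.mem_ofPred_eq, List.length_eq_zero_iff, Set.mem_singleton_iff,
    and_iff_left_iff_imp]
  rintro rfl
  exact isNormal_singleton.2 x.2

/-- The last entry of a prefix splits off. -/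
noncomputable def normalPrefixesSuccEquiv (d : ℕ) (y : PosBraid (m + 1)) :
    (Σ x : {x : SimpleBraid (m + 1) // IsNormal [(x : PosBraid (m + 1)), y]},
      normalPrefixes d (x : PosBraid (m + 1))) ≃ normalPrefixes (d + 1) y :=
  Equiv.ofBijective
    (fun p => ⟨p.2.1 ++ [(p.1.1 : PosBraid (m + 1))], by
      obtain ⟨⟨x, hx⟩, l, hl⟩ := p
      refine ⟨by simp [hl.1], ?_⟩
      rw [List.append_assoc]
      exact isNormal_append_pair.2 ⟨hl.2, hx⟩⟩) (by
    constructor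
    · rintro ⟨⟨⟨x, hxs⟩, hx⟩, l, hl⟩ ⟨⟨⟨x', hxs'⟩, hx'⟩, l', hl'⟩ h
      have h2 := List.append_inj' (congrArg Subtype.val h) rfl
      obtain rfl : l = l' := h2.1
      obtain rfl : x = x' := (List.cons.inj h2.2).1
      rfl
    · rintro ⟨l, hl, hnorm⟩
      obtain rfl | ⟨l, x, rfl⟩ := l.eq_nil_or_concat'
      · simp at hl
      · rw [List.append_assoc] at hnorm
        have hx := (isNormal_append_pair.1 hnorm).2
        exact ⟨⟨⟨⟨x, hx.dvd_delta x (by simp)⟩, hx⟩, l, by simpa using hl,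
          (isNormal_append_pair.1 hnorm).1⟩, rfl⟩)

theorem finite_normalPrefixes (d : ℕ) (x : SimpleBraid (m + 1)) :
    Finite (normalPrefixes d (x : PosBraid (m + 1))) := by
  induction d generalizing x with
  | zero => rw [normalPrefixes_zero]; infer_instance
  | succ d ih => exact Finite.of_equiv _ (normalPrefixesSuccEquiv d _)

open Classical in
theorem card_normalPrefixes_succ (d : ℕ) (y : SimpleBraid (m + 1)) :
    Nat.card (normalPrefixes (d + 1) (y : PosBraid (m + 1))) =
      ∑ x : SimpleBraid (m + 1), Nat.card (normalPrefixes d (x : PosBraid (m + 1))) *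
        if IsNormal [(x : PosBraid (m + 1)), (y : PosBraid (m + 1))] then 1 else 0 := by
  have := fun x : SimpleBraid (m + 1) => finite_normalPrefixes d x
  rw [← Nat.card_congr (normalPrefixesSuccEquiv d _), Nat.card_sigma]
  simp only [mul_ite, mul_one, mul_zero]
  rw [← Finset.sum_filter]
  exact (Finset.sum_subtype _ (by simp)
    (fun x : SimpleBraid (m + 1) => Nat.card (normalPrefixes d (x : PosBraid (m + 1))))).symm

open Classical in
/-- The incidence matrix of normality, with natural number entries. -/
noncomputable def natNormalMatrix (n : ℕ) : Matrix (SimpleBraid n) (SimpleBraid n) ℕ :=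
  Matrix.of fun x y => if IsNormal [(x : PosBraid n), (y : PosBraid n)] then 1 else 0

theorem normalMatrix_eq_map (n : ℕ) :
    normalMatrix n = (natNormalMatrix n).map (Nat.castRingHom ℂ) := by
  ext x y
  simp [normalMatrix, natNormalMatrix]

/-- The fundamental braid as a simple braid. -/
def simpleDelta (n : ℕ) : SimpleBraid n := ⟨deltaBraid n, dvd_rfl⟩

theorem isNormal_delta_pair (x : SimpleBraid (m + 1)) :
    IsNormal [deltaBraid (m + 1), (x : PosBraid (m + 1))] := by
  refine ⟨⟨dvd_rfl, Dvd.intro _ rfl, fun c hc _ => hc⟩, isNormal_singleton.2 x.2⟩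

open Classical in
-- Put `Δ` in front of a normal sequence: it stays normal, so sequences of length `d` ending in `x`
-- are the paths with `d` steps from `Δ` to `x`. The convention for `d = 0` is the empty path.
theorem braidCount_eq_pow_apply (d : ℕ) (x : SimpleBraid (m + 1)) :
    braidCount (m + 1) d x = (natNormalMatrix (m + 1) ^ d) (simpleDelta (m + 1)) x := by
  cases d with
  | zero =>
    rw [braidCount, if_pos rfl, pow_zero, Matrix.one_apply]
    simp only [simpleDelta, Subtype.ext_iff, eq_comm]
  | succ d =>
    rw [braidCount, if_neg (Nat.succ_ne_zero d), ncard_braidsWithFactor_succ]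
    induction d generalizing x with
    | zero =>
      rw [normalPrefixes_zero, zero_add, pow_one, natNormalMatrix, Matrix.of_apply,
        if_pos (show IsNormal [(simpleDelta (m + 1) : PosBraid (m + 1)), (x : PosBraid (m + 1))] from
          isNormal_delta_pair x)]
      simp
    | succ d ih =>
      rw [card_normalPrefixes_succ, pow_succ, Matrix.mul_apply]
      exact Finset.sum_congr rfl fun y _ => by rw [ih y]; rfl

end Counting

/-! ### Double cosets of Young subgroups and their longest representatives. -/

section DoubleCosets

open Equiv

variable {m : ℕ}

/-- The set of descents of a permutation. -/
def descents (w : Perm (Fin (m + 1))) : Finset (Fin m) :=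
  Finset.univ.filter fun i => w i.succ < w i.castSucc

theorem mem_descents {w : Perm (Fin (m + 1))} {i : Fin m} :
    i ∈ descents w ↔ w i.succ < w i.castSucc := by
  simp [descents]

/-- Cut `{0, …, m}` between `i` and `i + 1` for each `i ∉ S`; this is the index of the block
that contains `p`. -/
def blockIndex (S : Finset (Fin m)) (p : Fin (m + 1)) : ℕ :=
  (Finset.univ.filter fun i : Fin m => i ∉ S ∧ i.castSucc < p).card

theorem blockIndex_mono (S : Finset (Fin m)) : Monotone (blockIndex S) := fun _ _ h =>
  Finset.card_le_card fun i hi => by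
    simp only [Finset.mem_filter, Finset.mem_univ, true_and] at hi ⊢
    exact ⟨hi.1, hi.2.trans_le h⟩

theorem blockIndex_succ_of_mem {S : Finset (Fin m)} {i : Fin m} (hi : i ∈ S) :
    blockIndex S i.succ = blockIndex S i.castSucc := by
  refine congrArg Finset.card (Finset.filter_congr fun j _ => and_congr_right fun hj => ?_)
  have : j ≠ i := fun h => hj (h ▸ hi)
  simp only [Fin.lt_def, Fin.val_castSucc, Fin.val_succ, Ne, Fin.ext_iff] at this ⊢
  omega

theorem blockIndex_succ_of_notMem {S : Finset (Fin m)} {i : Fin m} (hi : i ∉ S) :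
    blockIndex S i.succ = blockIndex S i.castSucc + 1 := by
  rw [blockIndex, blockIndex, ← Finset.card_insert_of_notMem (a := i) (by simp)]
  congr 1
  ext j
  simp only [Finset.mem_filter, Finset.mem_univ, true_and, Finset.mem_insert, Fin.lt_def,
    Fin.val_castSucc, Fin.val_succ]
  constructor
  · rintro ⟨h1, h2⟩
    by_cases h : j = i
    · exact Or.inl h
    · exact Or.inr ⟨h1, by rw [Fin.ext_iff] at h; omega⟩
  · rintro (rfl | ⟨h1, h2⟩)
    · exact ⟨hi, by omega⟩
    · exact ⟨h1, by omega⟩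

theorem blockIndex_zero (S : Finset (Fin m)) : blockIndex S 0 = 0 := by
  rw [blockIndex, Finset.card_eq_zero, Finset.filter_eq_empty_iff]
  rintro i - ⟨-, h⟩
  exact absurd h (Fin.not_lt_zero _)

theorem blockIndex_last (S : Finset (Fin m)) : blockIndex S (Fin.last m) + S.card = m := by
  have : blockIndex S (Fin.last m) = Sᶜ.card := by
    rw [blockIndex]
    congr 1
    ext i
    simp [Fin.castSucc_lt_last]
  rw [this, Finset.card_compl, Fintype.card_fin]
  have := Finset.card_le_univ S
  rw [Fintype.card_fin] at this
  omega

theorem exists_blockIndex_eq (S : Finset (Fin m)) (q : Fin (m + 1)) :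
    ∀ j ≤ blockIndex S q, ∃ p, blockIndex S p = j := by
  induction q using Fin.induction with
  | zero =>
    intro j hj
    rw [blockIndex_zero] at hj
    exact ⟨0, by rw [blockIndex_zero]; omega⟩
  | succ i ih =>
    intro j hj
    by_cases hi : i ∈ S
    · exact ih j (by rwa [blockIndex_succ_of_mem hi] at hj)
    · rcases hj.eq_or_lt with rfl | hj
      · exact ⟨_, rfl⟩
      · rw [blockIndex_succ_of_notMem hi] at hj
        exact ih j (by omega)

theorem image_blockIndex (S : Finset (Fin m)) :
    Finset.univ.image (blockIndex S) = Finset.range (blockIndex S (Fin.last m) + 1) := by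
  ext j
  simp only [Finset.mem_image, Finset.mem_univ, true_and, Finset.mem_range, Nat.lt_succ_iff]
  constructor
  · rintro ⟨p, rfl⟩
    exact blockIndex_mono S (Fin.le_last p)
  · exact exists_blockIndex_eq S _ j

/-- A block is an interval whose consecutive points are joined by letters of `S`, so invariance
under these letters is constancy on blocks. -/
theorem eq_of_blockIndex_eq {S : Finset (Fin m)} {α : Type*} {f : Fin (m + 1) → α}
    (hf : ∀ i ∈ S, f i.castSucc = f i.succ) {p q : Fin (m + 1)}
    (h : blockIndex S p = blockIndex S q) : f p = f q := by
  have aux : ∀ q p : Fin (m + 1), p ≤ q → blockIndex S p = blockIndex S q → f p = f q := by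
    intro q
    induction q using Fin.induction with
    | zero =>
      intro p hp _
      rw [Fin.le_zero_iff.1 hp]
    | succ i ih =>
      intro p hp h
      rcases hp.eq_or_lt with rfl | hp
      · rfl
      · have hp' : p ≤ i.castSucc := Fin.le_castSucc_iff.2 hp
        have h1 := blockIndex_mono S hp'
        by_cases hi : i ∈ S
        · rw [blockIndex_succ_of_mem hi] at h
          rw [ih p hp' h, hf i hi]
        · rw [blockIndex_succ_of_notMem hi] at h
          omega
  rcases le_total p q with hpq | hpq
  · exact aux q p hpq h
  · exact (aux p q hpq h.symm).symm

/-- The Young subgroup of the permutations that preserve each block of `S`. -/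
def youngSubgroup (S : Finset (Fin m)) : Subgroup (Perm (Fin (m + 1))) where
  carrier := {g | ∀ p, blockIndex S (g p) = blockIndex S p}
  one_mem' _ := rfl
  mul_mem' ha hb p := (ha _).trans (hb p)
  inv_mem' {g} hg p := by
    have := hg (g⁻¹ p)
    rw [show g (g⁻¹ p) = p from g.apply_symm_apply p] at this
    exact this.symm

theorem mem_youngSubgroup {S : Finset (Fin m)} {g : Perm (Fin (m + 1))} :
    g ∈ youngSubgroup S ↔ ∀ p, blockIndex S (g p) = blockIndex S p := Iff.rfl

theorem adjSwap_mem_youngSubgroup {S : Finset (Fin m)} {i : Fin m} (hi : i ∈ S) :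
    adjSwap i ∈ youngSubgroup S := by
  intro p
  by_cases h1 : p = i.castSucc
  · rw [h1, adjSwap_castSucc, blockIndex_succ_of_mem hi]
  by_cases h2 : p = i.succ
  · rw [h2, adjSwap_succ, blockIndex_succ_of_mem hi]
  · rw [adjSwap, Equiv.swap_apply_of_ne_of_ne h1 h2]

/-- The permutations that are of maximal length in their double coset. -/
def maximalReps (U T : Finset (Fin m)) : Finset (Perm (Fin (m + 1))) :=
  Finset.univ.filter fun x => U ⊆ descents x⁻¹ ∧ T ⊆ descents x

theorem mem_maximalReps {U T : Finset (Fin m)} {x : Perm (Fin (m + 1))} :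
    x ∈ maximalReps U T ↔ U ⊆ descents x⁻¹ ∧ T ⊆ descents x := by
  simp [maximalReps]

/-- An element of the double coset with the most inversions works: an ascent at a letter of `U` or
`T` would allow a longer element. -/
theorem exists_mem_maximalReps (U T : Finset (Fin m)) (x : Perm (Fin (m + 1))) :
    ∃ a ∈ youngSubgroup U, ∃ b ∈ youngSubgroup T, a * x * b⁻¹ ∈ maximalReps U T := by
  obtain ⟨⟨⟨a, ha⟩, ⟨b, hb⟩⟩, hmax⟩ := Finite.exists_max
    (fun p : youngSubgroup U × youngSubgroup T =>
      invNum ((p.1 : Perm (Fin (m + 1))) * x * (p.2 : Perm (Fin (m + 1)))⁻¹))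
  refine ⟨a, ha, b, hb, mem_maximalReps.2 ⟨fun i hi => ?_, fun i hi => ?_⟩⟩
  · rw [mem_descents]
    by_contra h
    have h1 := invNum_mul_adjSwap_of_lt
      (lt_of_le_of_ne (not_lt.1 h) (apply_castSucc_ne_succ _ _))
    have h2 := hmax ⟨⟨adjSwap i * a, mul_mem (adjSwap_mem_youngSubgroup hi) ha⟩, ⟨b, hb⟩⟩
    rw [← invNum_inv, mul_inv_rev, inv_inv, adjSwap_inv, invNum_inv] at h1
    simp only [mul_assoc] at h1 h2
    omega
  · rw [mem_descents]
    by_contra h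
    have h1 := invNum_mul_adjSwap_of_lt
      (lt_of_le_of_ne (not_lt.1 h) (apply_castSucc_ne_succ _ _))
    have h2 := hmax ⟨⟨a, ha⟩, ⟨adjSwap i * b, mul_mem (adjSwap_mem_youngSubgroup hi) hb⟩⟩
    simp only [mul_inv_rev, adjSwap_inv, mul_assoc] at h1 h2
    omega

theorem monotone_toLex_of_subset_descents {T : Finset (Fin m)} {x : Perm (Fin (m + 1))}
    (hT : T ⊆ descents x) {α : Type*} [LinearOrder α] {f : Fin (m + 1) → α} (hf : Monotone f) :
    Monotone fun p => toLex (blockIndex T p, OrderDual.toDual (f (x p))) := by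
  refine Fin.monotone_iff_le_succ.2 fun i => ?_
  rw [Prod.Lex.toLex_le_toLex]
  by_cases hi : i ∈ T
  · refine Or.inr ⟨(blockIndex_succ_of_mem hi).symm, ?_⟩
    exact hf (mem_descents.1 (hT hi)).le
  · refine Or.inl ?_
    rw [blockIndex_succ_of_notMem hi]
    exact Nat.lt_succ_self _

/-- A sequence has only one monotone rearrangement. Since `x` and `y` decrease on the blocks of `T`,
their labels by block of `U` are sorted in reverse inside each block; the labels of `y` rearrange
those of `x`, so they agree. The same argument for the inverses then recovers the permutation. -/
theorem maximalReps_unique {U T : Finset (Fin m)} {x y a b : Perm (Fin (m + 1))}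
    (hx : x ∈ maximalReps U T) (hy : y ∈ maximalReps U T) (ha : a ∈ youngSubgroup U)
    (hb : b ∈ youngSubgroup T) (h : y = a * x * b⁻¹) : x = y := by
  rw [mem_maximalReps] at hx hy
  have h1 : ∀ p, blockIndex U (x p) = blockIndex U (y p) := by
    have hmx := monotone_toLex_of_subset_descents hx.2 (blockIndex_mono U)
    have hmy := monotone_toLex_of_subset_descents hy.2 (blockIndex_mono U)
    have he : (fun p => toLex (blockIndex T p, OrderDual.toDual (blockIndex U (y p)))) =
        (fun p => toLex (blockIndex T p, OrderDual.toDual (blockIndex U (x p)))) ∘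
          ((b⁻¹ : Perm (Fin (m + 1))) : Fin (m + 1) → Fin (m + 1)) := by
      funext p
      simp only [Function.comp_apply, h, Perm.mul_apply, ha _]
      rw [inv_mem hb p]
    rw [he] at hmy
    have := Tuple.unique_monotone (σ := 1) hmx hmy
    rw [← he] at this
    intro p
    simpa using congrArg (fun z => (ofLex z).2) (congrFun this p)
  have hmx := monotone_toLex_of_subset_descents hx.1 monotone_id
  have hmy := monotone_toLex_of_subset_descents hy.1 monotone_id
  have he : (fun p => toLex (blockIndex U p, OrderDual.toDual (id (y⁻¹ p)))) =
      (fun p => toLex (blockIndex U p, OrderDual.toDual (id (x⁻¹ p)))) ∘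
        ((x * y⁻¹ : Perm (Fin (m + 1))) : Fin (m + 1) → Fin (m + 1)) := by
    funext p
    simp [h1]
  rw [he] at hmy
  have := Tuple.unique_monotone (σ := 1) hmx hmy
  rw [← he] at this
  refine inv_injective (Equiv.ext fun p => ?_)
  simpa using congrArg (fun z => (ofLex z).2) (congrFun this p)

/-- The action of `H × K` on the ambient group by `(a, b) • x = a x b⁻¹`. -/
@[reducible] def doubleCosetAction {G : Type*} [Group G] (H K : Subgroup G) : MulAction (H × K) G where
  smul p x := p.1 * x * (p.2 : G)⁻¹
  one_smul x := by
    change ((1 : H) : G) * x * ((1 : K) : G)⁻¹ = x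
    simp
  mul_smul p q x := by
    change ((p.1 * q.1 : H) : G) * x * ((p.2 * q.2 : K) : G)⁻¹ =
      p.1 * (q.1 * x * (q.2 : G)⁻¹) * (p.2 : G)⁻¹
    simp [mul_assoc]

/-- The number of conjugators carrying `g` into the subgroup `H`. -/
noncomputable def conjCount {G : Type*} [Group G] (H : Subgroup G) (g : G) : ℕ :=
  Nat.card {x : G // x * g * x⁻¹ ∈ H}

/-- Triples `(g, x, y)` with `x g x⁻¹ ∈ H` and `y g y⁻¹ ∈ K`, in terms of the fixed points of
the action on double cosets. -/
def conjPairsEquiv {G : Type*} [Group G] (H K : Subgroup G) :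
    (Σ g : G, {x : G // x * g * x⁻¹ ∈ H} × {y : G // y * g * y⁻¹ ∈ K}) ≃
      G × {q : (H × K) × G // q.1.1 * q.2 * (q.1.2 : G)⁻¹ = q.2} where
  -- The triple becomes `a = x g x⁻¹`, `b = y g y⁻¹`, `z = x y⁻¹` with `a z b⁻¹ = z`. Keeping `x`
  -- makes this reversible: `g = x⁻¹ a x` and `y = z⁻¹ x`.
  toFun t := ⟨t.2.1, ⟨⟨⟨_, t.2.1.2⟩, ⟨_, t.2.2.2⟩⟩, t.2.1 * (t.2.2 : G)⁻¹⟩, by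
    simp [mul_assoc]⟩
  invFun s := ⟨s.1⁻¹ * s.2.1.1.1 * s.1, ⟨s.1, by simp [mul_assoc]⟩, ⟨s.2.1.2⁻¹ * s.1, by
    obtain ⟨x, ⟨⟨⟨a, ha⟩, ⟨b, hb⟩⟩, z⟩, h⟩ := s
    have h' : a * z * b⁻¹ = z := h
    have : z⁻¹ * x * (x⁻¹ * a * x) * (z⁻¹ * x)⁻¹ = b := by
      rw [mul_inv_eq_iff_eq_mul] at h'
      have h2 : z⁻¹ * (a * z) = b := by rw [h', inv_mul_cancel_left]
      rw [← h2]
      group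
    simpa only [this] using hb⟩⟩
  left_inv t := by
    obtain ⟨g, ⟨x, hx⟩, ⟨y, hy⟩⟩ := t
    have h1 : x⁻¹ * (x * g * x⁻¹) * x = g := by group
    have h2 : (x * y⁻¹)⁻¹ * x = y := by group
    simp only [h2]
    congr!
  right_inv s := by
    obtain ⟨x, ⟨⟨⟨a, ha⟩, ⟨b, hb⟩⟩, z⟩, h⟩ := s
    have h' : a * z * b⁻¹ = z := h
    have h1 : x * (x⁻¹ * a * x) * x⁻¹ = a := by group
    have h3 : z⁻¹ * x * (x⁻¹ * a * x) * (z⁻¹ * x)⁻¹ = b := by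
      rw [mul_inv_eq_iff_eq_mul] at h'
      have h2 : z⁻¹ * (a * z) = b := by rw [h', inv_mul_cancel_left]
      rw [← h2]
      group
    have h4 : x * (z⁻¹ * x)⁻¹ = z := by group
    simp only [h1, h3, h4]

/-- Burnside's lemma for the action on both sides; the orbits are the double cosets, each with
exactly one maximal representative. -/
theorem card_fixed_pairs (U T : Finset (Fin m)) :
    Nat.card {q : (youngSubgroup U × youngSubgroup T) × Perm (Fin (m + 1)) //
        q.1.1 * q.2 * (q.1.2 : Perm (Fin (m + 1)))⁻¹ = q.2} =
      (maximalReps U T).card * (Nat.card (youngSubgroup U) * Nat.card (youngSubgroup T)) := by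
  let := doubleCosetAction (youngSubgroup U) (youngSubgroup T)
  have hsmul : ∀ (p : youngSubgroup U × youngSubgroup T) (x : Perm (Fin (m + 1))),
      p • x = p.1 * x * (p.2 : Perm (Fin (m + 1)))⁻¹ := fun _ _ => rfl
  let e : {q : (youngSubgroup U × youngSubgroup T) × Perm (Fin (m + 1)) //
        q.1.1 * q.2 * (q.1.2 : Perm (Fin (m + 1)))⁻¹ = q.2} ≃
      Σ p : youngSubgroup U × youngSubgroup T, MulAction.fixedBy (Perm (Fin (m + 1))) p :=
    { toFun := fun q => ⟨q.1.1, q.1.2, q.2⟩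
      invFun := fun s => ⟨⟨s.1, s.2⟩, s.2.2⟩
      left_inv := fun _ => rfl
      right_inv := fun _ => rfl }
  rw [Nat.card_congr e, Nat.card_congr (MulAction.sigmaFixedByEquivOrbitsProdGroup _ _),
    Nat.card_prod, Nat.card_prod]
  congr 1
  rw [← Nat.card_eq_finsetCard]
  symm
  refine Nat.card_eq_of_bijective (fun x : maximalReps U T =>
    (Quotient.mk (MulAction.orbitRel (youngSubgroup U × youngSubgroup T) (Perm (Fin (m + 1))))
      x.1)) ⟨?_, ?_⟩
  · rintro ⟨x, hx⟩ ⟨y, hy⟩ h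
    obtain ⟨p, hp⟩ := MulAction.orbitRel_apply.1 (Quotient.exact h)
    exact Subtype.ext (maximalReps_unique hy hx p.1.2 p.2.2 hp.symm).symm
  · intro q
    obtain ⟨x, rfl⟩ := Quotient.exists_rep q
    obtain ⟨a, ha, b, hb, h⟩ := exists_mem_maximalReps U T x
    exact ⟨⟨_, h⟩, Quotient.sound (MulAction.orbitRel_apply.2 ⟨⟨⟨a, ha⟩, ⟨b, hb⟩⟩, rfl⟩)⟩

/-- Up to the factor `|H|`, `conjCount H` is the permutation character on the cosets of `H`, so this
is the inner product formula for two such characters. -/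
theorem sum_conjCount_mul_conjCount (U T : Finset (Fin m)) :
    ∑ g : Perm (Fin (m + 1)), conjCount (youngSubgroup U) g * conjCount (youngSubgroup T) g =
      Nat.card (Perm (Fin (m + 1))) *
        ((maximalReps U T).card * (Nat.card (youngSubgroup U) * Nat.card (youngSubgroup T))) := by
  rw [← card_fixed_pairs, ← Nat.card_prod, ← Nat.card_congr (conjPairsEquiv _ _), Nat.card_sigma]
  exact Finset.sum_congr rfl fun g _ => (Nat.card_prod _ _).symm

end DoubleCosets

/-! ### Types of descent sets, and injectivity of the transfer operator on functions of the type. -/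

section Types

open Equiv

variable {m : ℕ}

/-- Two sets of letters have the same type if some permutation carries the blocks of the first to
the blocks of the second; in other words, if their Young subgroups are conjugate. -/
def SameType (S T : Finset (Fin m)) : Prop :=
  ∃ x : Perm (Fin (m + 1)), ∀ p q,
    blockIndex S p = blockIndex S q ↔ blockIndex T (x p) = blockIndex T (x q)

theorem SameType.refl (S : Finset (Fin m)) : SameType S S := ⟨1, fun _ _ => Iff.rfl⟩

theorem SameType.symm {S T : Finset (Fin m)} (h : SameType S T) : SameType T S := by
  obtain ⟨x, hx⟩ := h
  refine ⟨x.symm, fun p q => ?_⟩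
  rw [hx, apply_symm_apply, apply_symm_apply]

theorem SameType.trans {S T U : Finset (Fin m)} (h : SameType S T) (h' : SameType T U) :
    SameType S U := by
  obtain ⟨x, hx⟩ := h
  obtain ⟨y, hy⟩ := h'
  exact ⟨y * x, fun p q => (hx p q).trans (hy _ _)⟩

/-- The equivalence relation of having the same type. -/
def typeSetoid (m : ℕ) : Setoid (Finset (Fin m)) where
  r := SameType
  iseqv := ⟨SameType.refl, SameType.symm, SameType.trans⟩

/-- The hypothesis says that `x` maps blocks of `S` into blocks of `U`, which induces a surjection
`β` on blocks. As `S` has `m + 1 - |S|` blocks, this gives the inequality, and equality makes `β`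
injective, so that `x` matches the blocks. -/
theorem card_le_of_blockIndex {S U : Finset (Fin m)} {x : Perm (Fin (m + 1))}
    (h : ∀ i ∈ S, blockIndex U (x i.castSucc) = blockIndex U (x i.succ)) :
    S.card ≤ U.card ∧ (U.card ≤ S.card → SameType S U) := by
  have hfac : Function.FactorsThrough (fun p => blockIndex U (x p)) (blockIndex S) :=
    fun p q hpq => eq_of_blockIndex_eq (f := fun p => blockIndex U (x p)) h hpq
  obtain ⟨β, hβ⟩ := (Function.factorsThrough_iff _).1 hfac
  have hβ' : ∀ p, β (blockIndex S p) = blockIndex U (x p) := fun p => (congrFun hβ p).symm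
  have himg : (Finset.univ.image (blockIndex S)).image β = Finset.univ.image (blockIndex U) := by
    ext j
    simp only [Finset.mem_image, Finset.mem_univ, true_and, exists_exists_eq_and, hβ']
    constructor
    · rintro ⟨p, rfl⟩
      exact ⟨_, rfl⟩
    · rintro ⟨p, rfl⟩
      exact ⟨x.symm p, by rw [apply_symm_apply]⟩
  have hS := blockIndex_last S
  have hU := blockIndex_last U
  have hcS : (Finset.univ.image (blockIndex S)).card = blockIndex S (Fin.last m) + 1 := by
    rw [image_blockIndex, Finset.card_range]
  have hcU : (Finset.univ.image (blockIndex U)).card = blockIndex U (Fin.last m) + 1 := by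
    rw [image_blockIndex, Finset.card_range]
  have hle := Finset.card_image_le (s := Finset.univ.image (blockIndex S)) (f := β)
  rw [himg, hcS, hcU] at hle
  refine ⟨by omega, fun hUS => ⟨x, fun p q => ⟨fun hpq => ?_, fun hpq => ?_⟩⟩⟩
  · rw [← hβ', ← hβ', hpq]
  · have hinj : Set.InjOn β (Finset.univ.image (blockIndex S)) :=
      Finset.injOn_of_card_image_eq (by rw [himg, hcU, hcS]; omega)
    rw [← hβ', ← hβ'] at hpq
    exact hinj (by simp) (by simp) hpq

theorem SameType.card_le {S T : Finset (Fin m)} (h : SameType S T) : S.card ≤ T.card := by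
  obtain ⟨x, hx⟩ := h
  exact (card_le_of_blockIndex (x := x) fun i hi =>
    (hx _ _).1 (blockIndex_succ_of_mem hi).symm).1

theorem SameType.card_eq {S T : Finset (Fin m)} (h : SameType S T) : S.card = T.card :=
  h.card_le.antisymm h.symm.card_le

theorem SameType.exists_conj {S T : Finset (Fin m)} (h : SameType S T) :
    ∃ x : Perm (Fin (m + 1)), ∀ g, g ∈ youngSubgroup S ↔ x * g * x⁻¹ ∈ youngSubgroup T := by
  obtain ⟨x, hx⟩ := h
  refine ⟨x, fun g => ?_⟩
  rw [mem_youngSubgroup, mem_youngSubgroup, ← x.forall_congr_right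
    (q := fun q => blockIndex T ((x * g * x⁻¹) q) = blockIndex T q)]
  simp [hx]

theorem SameType.conjCount_eq {S T : Finset (Fin m)} (h : SameType S T)
    (g : Perm (Fin (m + 1))) :
    conjCount (youngSubgroup S) g = conjCount (youngSubgroup T) g := by
  obtain ⟨x, hx⟩ := h.exists_conj
  refine Nat.card_congr ((Equiv.mulLeft x).subtypeEquiv fun z => ?_)
  rw [hx]
  simp [mul_assoc]

theorem SameType.card_youngSubgroup_eq {S T : Finset (Fin m)} (h : SameType S T) :
    Nat.card (youngSubgroup S) = Nat.card (youngSubgroup T) := by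
  obtain ⟨x, hx⟩ := h.exists_conj
  exact Nat.card_congr ((MulAut.conj x).toEquiv.subtypeEquiv hx)

theorem card_youngSubgroup_pos (S : Finset (Fin m)) : 0 < Nat.card (youngSubgroup S) :=
  Nat.card_pos

/-- Conjugation does not respect maximal length, so the comparison goes through the character sums,
which see Young subgroups only up to conjugacy. -/
theorem SameType.card_maximalReps_eq {T T' : Finset (Fin m)} (h : SameType T T')
    (U : Finset (Fin m)) : (maximalReps U T).card = (maximalReps U T').card := by
  have h1 := sum_conjCount_mul_conjCount U T
  have h2 := sum_conjCount_mul_conjCount U T'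
  simp only [h.conjCount_eq, h.card_youngSubgroup_eq, h2] at h1
  have h3 := Nat.eq_of_mul_eq_mul_left Nat.card_pos h1
  exact (Nat.eq_of_mul_eq_mul_right
    (mul_pos (card_youngSubgroup_pos U) (card_youngSubgroup_pos T')) h3).symm

/-- An element of the Young subgroup of `S` whose cycles are the blocks of `S`. -/
theorem exists_coxeterElement (S : Finset (Fin m)) : ∃ g : Perm (Fin (m + 1)),
    g ∈ youngSubgroup S ∧ (∀ i ∈ S, g i.castSucc = i.succ) := by
  -- Letters are added in increasing order. The last clause says that `g` fixes every point beyond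
  -- the letters used, so that `g` times the next transposition sends `a` to `a + 1`.
  suffices H : ∀ S' ⊆ S, ∃ g : Perm (Fin (m + 1)), g ∈ youngSubgroup S ∧
      (∀ i ∈ S', g i.castSucc = i.succ) ∧ ∀ p, (∀ i ∈ S', i.succ < p) → g p = p by
    obtain ⟨g, h1, h2, -⟩ := H S subset_rfl
    exact ⟨g, h1, h2⟩
  intro S'
  induction S' using Finset.induction_on_max with
  | empty => exact fun _ => ⟨1, one_mem _, by simp, by simp⟩
  | insert a S' ha ih =>
    intro hS
    obtain ⟨g, h1, h2, h3⟩ := ih ((Finset.subset_insert _ _).trans hS)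
    refine ⟨g * adjSwap a, mul_mem h1 (adjSwap_mem_youngSubgroup (hS (by simp))), ?_, ?_⟩
    · intro i hi
      rw [Finset.mem_insert] at hi
      rw [Perm.mul_apply]
      rcases hi with rfl | hi
      · rw [adjSwap_castSucc, h3]
        intro j hj
        exact Fin.succ_lt_succ_iff.2 (ha j hj)
      · have := ha i hi
        rw [Fin.lt_def] at this
        rw [adjSwap_of_ne (by simp; omega) (by simp; omega), h2 i hi]
    · intro p hp
      have := hp a (by simp)
      rw [Fin.lt_def, Fin.val_succ] at this
      rw [Perm.mul_apply, adjSwap_of_ne (by omega) (by omega)]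
      exact h3 p fun i hi => hp i (by simp [hi])

theorem conjCount_self_ne_zero {G : Type*} [Group G] [Finite G] {H : Subgroup G} {g : G}
    (hg : g ∈ H) : conjCount H g ≠ 0 := by
  have : Nonempty {x : G // x * g * x⁻¹ ∈ H} := ⟨1, by simpa using hg⟩
  exact Nat.card_pos.ne'

theorem card_le_of_conjCount_ne_zero {S U : Finset (Fin m)} {g : Perm (Fin (m + 1))}
    (hg : ∀ i ∈ S, g i.castSucc = i.succ) (h : conjCount (youngSubgroup U) g ≠ 0) :
    S.card ≤ U.card ∧ (U.card ≤ S.card → SameType S U) := by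
  have : Nonempty {x : Perm (Fin (m + 1)) // x * g * x⁻¹ ∈ youngSubgroup U} := by
    by_contra hne
    rw [not_nonempty_iff] at hne
    exact h Nat.card_of_isEmpty
  obtain ⟨x, hx⟩ := this
  refine card_le_of_blockIndex (x := x) fun i hi => ?_
  have := hx (x i.castSucc)
  simp only [Perm.mul_apply, show x⁻¹ (x i.castSucc) = i.castSucc from x.symm_apply_apply _,
    hg i hi] at this
  exact this.symm

open Classical in
theorem sum_eq_zero_of_type_sums {F : Finset (Finset (Fin m))} {a φ : Finset (Fin m) → ℂ}
    (hF : ∀ S ∈ F, ∀ T, SameType S T → T ∈ F) (hφ : ∀ S T, SameType S T → φ S = φ T)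
    (ha : ∀ S ∈ F, ∑ U with SameType U S, a U = 0) : ∑ U ∈ F, a U * φ U = 0 := by
  refine Finset.sum_cancels_of_partition_cancels (typeSetoid m) fun S hS => ?_
  have h1 : F.filter (fun U => SameType U S) = Finset.univ.filter fun U => SameType U S := by
    ext U
    simp only [Finset.mem_filter, Finset.mem_univ, true_and, and_iff_right_iff_imp]
    exact fun h => hF S hS U h.symm
  calc ∑ U ∈ F with SameType U S, a U * φ U = ∑ U with SameType U S, a U * φ S := by
        rw [h1]
        exact Finset.sum_congr rfl fun U hU => by rw [hφ U S (Finset.mem_filter.1 hU).2]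
    _ = 0 := by rw [← Finset.sum_mul, ha S hS, zero_mul]

open Classical in
-- Linear independence of the characters of distinct types, by downward induction on `|S|`. At a
-- Coxeter element of `S`, the types of larger sets cancel by induction, and among the other sets
-- only those of the type of `S` have a nonzero value.
theorem type_sum_eq_zero {a : Finset (Fin m) → ℂ}
    (ha : ∀ g : Perm (Fin (m + 1)), ∑ U, a U * conjCount (youngSubgroup U) g = 0)
    (S : Finset (Fin m)) : ∑ U with SameType U S, a U = 0 := by
  induction hN : m - S.card using Nat.strong_induction_on generalizing S with
  | _ N ih =>
    obtain ⟨g, hgS, hg⟩ := exists_coxeterElement S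
    have hlarge : ∑ U with S.card < U.card, a U * (conjCount (youngSubgroup U) g : ℂ) = 0 := by
      refine sum_eq_zero_of_type_sums (φ := fun U => (conjCount (youngSubgroup U) g : ℂ)) ?_ ?_ ?_
      · intro U hU T hUT
        simpa [← hUT.card_eq] using hU
      · intro U T h
        simp only [h.conjCount_eq]
      · intro U hU
        have h1 := (Finset.mem_filter.1 hU).2
        have h2 := Finset.card_le_univ U
        rw [Fintype.card_fin] at h2
        exact ih _ (by omega) U rfl
    have hsmall : ∑ U with ¬ S.card < U.card, a U * (conjCount (youngSubgroup U) g : ℂ) =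
        ∑ U with SameType U S, a U * (conjCount (youngSubgroup U) g : ℂ) := by
      symm
      refine Finset.sum_subset ?_ ?_
      · intro U hU
        have := (Finset.mem_filter.1 hU).2.card_eq
        simp [this]
      · intro U hU hU'
        by_cases h0 : conjCount (youngSubgroup U) g = 0
        · simp [h0]
        · have h1 := (card_le_of_conjCount_ne_zero hg h0).2 (not_lt.1 (Finset.mem_filter.1 hU).2)
          exact (hU' (Finset.mem_filter.2 ⟨Finset.mem_univ _, h1.symm⟩)).elim
    have htot := ha g
    rw [← Finset.sum_filter_add_sum_filter_not _ (fun U : Finset (Fin m) => S.card < U.card),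
      hlarge, hsmall, zero_add] at htot
    have hconst : ∑ U with SameType U S, a U * (conjCount (youngSubgroup U) g : ℂ) =
        (∑ U with SameType U S, a U) * (conjCount (youngSubgroup S) g : ℂ) := by
      rw [Finset.sum_mul]
      exact Finset.sum_congr rfl fun U hU => by
        rw [(Finset.mem_filter.1 hU).2.conjCount_eq]
    rw [hconst] at htot
    exact (mul_eq_zero.1 htot).resolve_right
      (Nat.cast_ne_zero.2 (conjCount_self_ne_zero hgS))

/-- The pairing of double coset numbers is positive on combinations of permutation characters. -/
theorem sum_conjCount_eq_zero {w : Finset (Fin m) → ℂ}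
    (hw : ∀ T, ∑ U, w U * ((maximalReps U T).card : ℂ) = 0) (g : Perm (Fin (m + 1))) :
    ∑ U, (w U / Nat.card (youngSubgroup U)) * (conjCount (youngSubgroup U) g : ℂ) = 0 := by
  set Φ : Perm (Fin (m + 1)) → ℂ := fun g =>
    ∑ U, (w U / Nat.card (youngSubgroup U)) * (conjCount (youngSubgroup U) g : ℂ) with hΦ
  have hc : ∀ U : Finset (Fin m), (Nat.card (youngSubgroup U) : ℂ) ≠ 0 := fun U =>
    Nat.cast_ne_zero.2 (card_youngSubgroup_pos U).ne'
  have hprod : ∀ U T : Finset (Fin m), ∑ g, (conjCount (youngSubgroup U) g : ℂ) *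
      (conjCount (youngSubgroup T) g : ℂ) = Nat.card (Perm (Fin (m + 1))) *
        ((maximalReps U T).card * (Nat.card (youngSubgroup U) * Nat.card (youngSubgroup T))) :=
    fun U T => by exact_mod_cast sum_conjCount_mul_conjCount U T
  have hT : ∀ T, ∑ g, Φ g * (conjCount (youngSubgroup T) g : ℂ) = 0 := by
    intro T
    calc ∑ g, Φ g * (conjCount (youngSubgroup T) g : ℂ)
        = ∑ U, (w U / Nat.card (youngSubgroup U)) * ∑ g, (conjCount (youngSubgroup U) g : ℂ) *
          (conjCount (youngSubgroup T) g : ℂ) := by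
          simp only [hΦ, Finset.sum_mul, Finset.mul_sum]
          rw [Finset.sum_comm]
          simp only [mul_assoc]
      _ = Nat.card (Perm (Fin (m + 1))) * Nat.card (youngSubgroup T) *
          ∑ U, w U * ((maximalReps U T).card : ℂ) := by
          rw [Finset.mul_sum]
          refine Finset.sum_congr rfl fun U _ => ?_
          rw [hprod]
          field_simp [hc U]
      _ = 0 := by rw [hw, mul_zero]
  -- The conjugate of `Φ` is again a combination of the real functions `conjCount`, to each of which
  -- `Φ` is orthogonal by `hT`; so `Φ` is orthogonal to itself.
  have hnorm : ∑ g, Complex.normSq (Φ g) = 0 := by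
    have : ∑ g, Φ g * (starRingEnd ℂ) (Φ g) = 0 := by
      have hconj : ∀ g, (starRingEnd ℂ) (Φ g) = ∑ T, (starRingEnd ℂ)
          (w T / Nat.card (youngSubgroup T)) * (conjCount (youngSubgroup T) g : ℂ) := by
        intro g
        simp only [hΦ, map_sum, map_mul, map_natCast]
      simp only [hconj, Finset.mul_sum]
      rw [Finset.sum_comm]
      refine Finset.sum_eq_zero fun T _ => ?_
      have := congrArg (fun z => (starRingEnd ℂ) (w T / Nat.card (youngSubgroup T)) * z) (hT T)
      simp only [mul_zero, Finset.mul_sum] at this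
      rw [← this]
      exact Finset.sum_congr rfl fun g _ => by ring
    simp only [Complex.mul_conj] at this
    exact_mod_cast this
  have := (Finset.sum_eq_zero_iff_of_nonneg fun g _ => Complex.normSq_nonneg (Φ g)).1 hnorm g
    (Finset.mem_univ g)
  exact Complex.normSq_eq_zero.1 this

/-- Möbius inversion on subsets, with `w` defined by recursion over strict subsets. -/
theorem exists_sum_powerset (f : Finset (Fin m) → ℂ) :
    ∃ w : Finset (Fin m) → ℂ, ∀ S, f S = ∑ U ∈ S.powerset, w U := by
  refine ⟨Finset.strongInduction fun S w => f S - ∑ U ∈ S.ssubsets.attach,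
    w U.1 (Finset.mem_ssubsets.1 U.2), fun S => ?_⟩
  rw [← Finset.add_sum_erase _ _ (Finset.mem_powerset_self S), Finset.strongInduction_eq,
    Finset.sum_attach S.ssubsets
      (fun U => Finset.strongInduction (fun S w => f S - ∑ U ∈ S.ssubsets.attach,
        w U.1 (Finset.mem_ssubsets.1 U.2)) U)]
  simp [Finset.ssubsets]

/-- The transfer operator on functions of the left descent set. -/
noncomputable def descentTransfer (f : Finset (Fin m) → ℂ) (T : Finset (Fin m)) : ℂ :=
  ∑ x : Perm (Fin (m + 1)), if T ⊆ descents x then f (descents x⁻¹) else 0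

theorem descentTransfer_eq {f w : Finset (Fin m) → ℂ}
    (hw : ∀ S, f S = ∑ U ∈ S.powerset, w U) (T : Finset (Fin m)) :
    descentTransfer f T = ∑ U, w U * ((maximalReps U T).card : ℂ) := by
  have h1 : ∀ U, w U * ((maximalReps U T).card : ℂ) =
      ∑ x : Perm (Fin (m + 1)), if U ⊆ descents x⁻¹ ∧ T ⊆ descents x then w U else 0 := by
    intro U
    rw [← Finset.sum_filter, Finset.sum_const, nsmul_eq_mul, mul_comm]
    rfl
  simp only [h1]
  rw [Finset.sum_comm, descentTransfer]
  refine Finset.sum_congr rfl fun x _ => ?_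
  by_cases hx : T ⊆ descents x
  · simp only [hx, if_true, and_true]
    rw [← Finset.sum_filter, hw]
    refine Finset.sum_congr ?_ fun _ _ => rfl
    ext U
    simp
  · simp [hx]

theorem descentTransfer_sameType (f : Finset (Fin m) → ℂ) {T T' : Finset (Fin m)}
    (h : SameType T T') : descentTransfer f T = descentTransfer f T' := by
  obtain ⟨w, hw⟩ := exists_sum_powerset f
  rw [descentTransfer_eq hw, descentTransfer_eq hw]
  simp only [h.card_maximalReps_eq]

/-- The Möbius coefficients `w` have vanishing sum over each type. By induction on `|S|`, if `w`
vanishes on smaller sets then `f = w` on sets of size `|S|`; as `f` is constant on types, the type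
sum is a positive multiple of `f S`. -/
theorem eq_zero_of_descentTransfer_eq_zero {f : Finset (Fin m) → ℂ}
    (hf : ∀ S T, SameType S T → f S = f T) (h : ∀ T, descentTransfer f T = 0) : f = 0 := by
  classical
  obtain ⟨w, hw⟩ := exists_sum_powerset f
  have h0 : ∀ T, ∑ U, w U * ((maximalReps U T).card : ℂ) = 0 := fun T => by
    rw [← descentTransfer_eq hw, h]
  have hsum : ∀ S, ∑ U with SameType U S, w U = 0 := by
    intro S
    have h1 := type_sum_eq_zero (sum_conjCount_eq_zero h0) S
    have h2 : ∑ U with SameType U S, w U / (Nat.card (youngSubgroup U) : ℂ) =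
        (∑ U with SameType U S, w U) / (Nat.card (youngSubgroup S) : ℂ) := by
      rw [Finset.sum_div]
      exact Finset.sum_congr rfl fun U hU => by
        rw [(Finset.mem_filter.1 hU).2.card_youngSubgroup_eq]
    rw [h2] at h1
    exact (div_eq_zero_iff.1 h1).resolve_right
      (Nat.cast_ne_zero.2 (card_youngSubgroup_pos S).ne')
  suffices H : ∀ N, ∀ S : Finset (Fin m), S.card = N → f S = 0 ∧ w S = 0 from
    funext fun S => (H _ S rfl).1
  intro N
  induction N using Nat.strong_induction_on with
  | _ N ih =>
    have hfw : ∀ S : Finset (Fin m), S.card = N → f S = w S := by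
      intro S hS
      rw [hw, ← Finset.add_sum_erase _ _ (Finset.mem_powerset_self S), add_eq_left]
      refine Finset.sum_eq_zero fun U hU => ?_
      have hU' := Finset.card_lt_card (Finset.mem_ssubsets.1 hU)
      exact (ih _ (by omega) U rfl).2
    intro S hS
    have h1 : ∑ U with SameType U S, w U = (Finset.univ.filter fun U => SameType U S).card * f S := by
      rw [← nsmul_eq_mul, ← Finset.sum_const]
      refine Finset.sum_congr rfl fun U hU => ?_
      have hUS := (Finset.mem_filter.1 hU).2
      rw [← hfw U (by rw [hUS.card_eq, hS]), hf U S hUS]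
    rw [hsum] at h1
    have hne : ((Finset.univ.filter fun U => SameType U S).card : ℂ) ≠ 0 :=
      Nat.cast_ne_zero.2 (Finset.card_pos.2 ⟨S, by simp [SameType.refl]⟩).ne'
    have hfS := (mul_eq_zero.1 h1.symm).resolve_left hne
    exact ⟨hfS, by rw [← hfw S hS, hfS]⟩

end Types

/-! ### Exponential polynomials from annihilating polynomials, and rational generating functions. -/

section LinearAlgebra

/-- Write `T = N + ρ` with `N ^ k` killing `u` and expand `T ^ d` by the binomial theorem: only `j <
k` survive, and `d.choose j` is a polynomial in `d` of degree `j`. -/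
theorem exists_polynomial_of_sub_pow_apply_eq_zero {V : Type*} [AddCommGroup V] [Module ℂ V]
    (T : Module.End ℂ V) (φ : V →ₗ[ℂ] ℂ) {ρ : ℂ} (hρ : ρ ≠ 0) {k : ℕ} {u : V}
    (hu : ((T - algebraMap ℂ _ ρ) ^ k) u = 0) :
    ∃ P : ℂ[X], P.natDegree ≤ k ∧ ∀ d : ℕ, φ ((T ^ d) u) = P.eval (d : ℂ) * ρ ^ d := by
  set N := T - algebraMap ℂ (Module.End ℂ V) ρ with hN
  have hzero : ∀ j, k ≤ j → (N ^ j) u = 0 := by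
    intro j hj
    obtain ⟨e, rfl⟩ := Nat.exists_eq_add_of_le' hj
    rw [pow_add, Module.End.mul_apply, hu, map_zero]
  have hexp : ∀ d, φ ((T ^ d) u) =
      ∑ j ∈ Finset.range k, (d.choose j : ℂ) * (ρ ^ d * (ρ⁻¹) ^ j) * φ ((N ^ j) u) := by
    intro d
    have hT : T = N + algebraMap ℂ (Module.End ℂ V) ρ := by rw [hN, sub_add_cancel]
    have hcomm : Commute N (algebraMap ℂ (Module.End ℂ V) ρ) := Algebra.commutes' ρ N |>.symm
    have h1 : φ ((T ^ d) u) = ∑ j ∈ Finset.range (d + 1),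
        (d.choose j : ℂ) * (ρ ^ d * (ρ⁻¹) ^ j) * φ ((N ^ j) u) := by
      rw [hT, hcomm.add_pow, LinearMap.sum_apply, map_sum]
      refine Finset.sum_congr rfl fun j hj => ?_
      have hj' : j ≤ d := Nat.lt_succ_iff.1 (Finset.mem_range.1 hj)
      have h2 : ρ ^ d * ρ⁻¹ ^ j = ρ ^ (d - j) := by
        rw [pow_sub₀ _ hρ hj', inv_pow]
      rw [h2, ← map_pow, ← map_natCast (algebraMap ℂ (Module.End ℂ V)), mul_assoc, ← map_mul,
        Module.End.mul_apply, Module.algebraMap_end_apply, map_smul, map_smul, smul_eq_mul]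
      ring
    rw [h1]
    have h3 : ∀ n, d < n ∨ k ≤ n → (d.choose n : ℂ) * (ρ ^ d * (ρ⁻¹) ^ n) * φ ((N ^ n) u) = 0 := by
      rintro n (hn | hn)
      · rw [Nat.choose_eq_zero_of_lt hn]; simp
      · rw [hzero n hn]; simp
    -- Both index ranges are enlarged to a common one, on which the additional terms vanish by `h3`.
    rw [Finset.sum_subset (Finset.range_mono (by omega : d + 1 ≤ d + 1 + k)),
      Finset.sum_subset (Finset.range_mono (by omega : k ≤ d + 1 + k))]
    · intro n _ hn
      exact h3 n (Or.inr (by simpa using hn))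
    · intro n _ hn
      exact h3 n (Or.inl (by simpa using hn))
  refine ⟨∑ j ∈ Finset.range k,
    Polynomial.C (ρ⁻¹ ^ j * φ ((N ^ j) u) / (j.factorial : ℂ)) * descPochhammer ℂ j, ?_, ?_⟩
  · refine Polynomial.natDegree_sum_le_of_forall_le _ _ fun j hj => ?_
    refine (Polynomial.natDegree_C_mul_le _ _).trans ?_
    rw [descPochhammer_natDegree]
    exact (Finset.mem_range.1 hj).le
  · intro d
    rw [hexp, Polynomial.eval_finsetSum, Finset.sum_mul]
    refine Finset.sum_congr rfl fun j _ => ?_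
    have hj : (j.factorial : ℂ) ≠ 0 := Nat.cast_ne_zero.2 j.factorial_ne_zero
    rw [Polynomial.eval_mul, Polynomial.eval_C, descPochhammer_eval_eq_descFactorial,
      Nat.descFactorial_eq_factorial_mul_choose, Nat.cast_mul]
    field_simp

/-- Primary decomposition of the single vector `u`: a Bézout identity for coprime factors splits it
into pieces killed by each power. -/
theorem exists_polynomials_of_aeval_prod_apply_eq_zero {V : Type*} [AddCommGroup V] [Module ℂ V]
    (T : Module.End ℂ V) (φ : V →ₗ[ℂ] ℂ) (s : Finset ℂ) (k : ℂ → ℕ) (hs : ∀ ρ ∈ s, ρ ≠ 0) (u : V)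
    (hu : Polynomial.aeval T (∏ ρ ∈ s, (Polynomial.X - Polynomial.C ρ) ^ k ρ) u = 0) :
    ∃ P : ℂ → ℂ[X], (∀ ρ ∈ s, (P ρ).natDegree ≤ k ρ) ∧
      ∀ d : ℕ, φ ((T ^ d) u) = ∑ ρ ∈ s, (P ρ).eval (d : ℂ) * ρ ^ d := by
  induction s using Finset.induction_on generalizing u with
  | empty =>
    simp only [Finset.prod_empty, map_one, Module.End.one_apply] at hu
    exact ⟨0, by simp, fun d => by simp [hu]⟩
  | insert ρ s hρ ih =>
    rw [Finset.prod_insert hρ] at hu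
    set p : ℂ[X] := (Polynomial.X - Polynomial.C ρ) ^ k ρ with hp
    set q : ℂ[X] := ∏ ρ ∈ s, (Polynomial.X - Polynomial.C ρ) ^ k ρ with hq
    have hcop : IsCoprime p q := by
      refine IsCoprime.prod_right fun τ hτ => IsCoprime.pow ?_
      exact Polynomial.isCoprime_X_sub_C_of_isUnit_sub
        (sub_ne_zero.2 (ne_of_mem_of_not_mem hτ hρ).symm).isUnit
    obtain ⟨a, b, hab⟩ := hcop
    have h1 : Polynomial.aeval T p (Polynomial.aeval T (b * q) u) = 0 := by
      rw [← Module.End.mul_apply, ← map_mul, show p * (b * q) = b * (p * q) by ring, map_mul,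
        Module.End.mul_apply, hu, map_zero]
    have h2 : Polynomial.aeval T q (Polynomial.aeval T (a * p) u) = 0 := by
      rw [← Module.End.mul_apply, ← map_mul, show q * (a * p) = a * (p * q) by ring, map_mul,
        Module.End.mul_apply, hu, map_zero]
    have hsum : u = Polynomial.aeval T (b * q) u + Polynomial.aeval T (a * p) u := by
      rw [← LinearMap.add_apply, ← map_add, add_comm, hab, map_one, Module.End.one_apply]
    obtain ⟨P, hP, hP'⟩ := ih (fun τ hτ => hs τ (Finset.mem_insert_of_mem hτ)) _ h2
    have h1' : ((T - algebraMap ℂ _ ρ) ^ k ρ) (Polynomial.aeval T (b * q) u) = 0 := by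
      simpa [hp] using h1
    obtain ⟨Q, hQ, hQ'⟩ := exists_polynomial_of_sub_pow_apply_eq_zero T φ
      (hs ρ (Finset.mem_insert_self _ _)) h1'
    have hne : ∀ τ ∈ s, τ ≠ ρ := fun τ hτ h => hρ (h ▸ hτ)
    refine ⟨Function.update P ρ Q, ?_, fun d => ?_⟩
    · intro τ hτ
      rcases Finset.mem_insert.1 hτ with rfl | hτ
      · rwa [Function.update_self]
      · rw [Function.update_of_ne (hne τ hτ)]
        exact hP τ hτ
    · rw [Finset.sum_insert hρ, Function.update_self]
      nth_rw 1 [hsum]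
      rw [map_add, map_add, hP', hQ']
      congr 1
      exact Finset.sum_congr rfl fun τ hτ => by rw [Function.update_of_ne (hne τ hτ)]

theorem eq_X_pow_mul_prod_of_monic {p : ℂ[X]} (hp : p.Monic) :
    p = Polynomial.X ^ p.rootMultiplicity 0 * ∏ ρ ∈ p.roots.toFinset.erase 0,
      (Polynomial.X - Polynomial.C ρ) ^ p.rootMultiplicity ρ := by
  have h1 : p = ∏ ρ ∈ p.roots.toFinset,
      (Polynomial.X - Polynomial.C ρ) ^ p.rootMultiplicity ρ := by
    conv_lhs => rw [(IsAlgClosed.splits p).eq_prod_roots_of_monic hp]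
    rw [Finset.prod_multiset_map_count]
    simp only [Polynomial.count_roots]
  by_cases h0 : (0 : ℂ) ∈ p.roots.toFinset
  · conv_lhs => rw [h1, ← Finset.mul_prod_erase _ _ h0, Polynomial.C_0, sub_zero]
  · have h2 : p.rootMultiplicity 0 = 0 := by
      rw [← Polynomial.count_roots, Multiset.count_eq_zero]
      simpa using h0
    rw [Finset.erase_eq_of_notMem h0, h2, pow_zero, one_mul]
    exact h1

theorem aeval_apply_mem {V : Type*} [AddCommGroup V] [Module ℂ V] {T : Module.End ℂ V}
    {W : Submodule ℂ V} (hW : ∀ v ∈ W, T v ∈ W) (p : ℂ[X]) {u : V} (hu : u ∈ W) :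
    Polynomial.aeval T p u ∈ W := by
  have hpow : ∀ d, (T ^ d) u ∈ W := by
    intro d
    induction d with
    | zero => exact hu
    | succ d ih => rw [pow_succ', Module.End.mul_apply]; exact hW _ ih
  rw [Polynomial.aeval_eq_sum_range, LinearMap.sum_apply]
  exact W.sum_mem fun d _ => W.smul_mem _ (hpow d)

/-- The denominator is the reversed polynomial, whose constant term is the leading coefficient `1`.
The recurrence kills all coefficients of the product from degree `c.natDegree` on, so the numerator
is its truncation. -/
theorem exists_rational_generatingFunction {c : ℚ[X]} (hc : c.Monic) {b : ℕ → ℚ}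
    (hb : ∀ d, ∑ k ∈ Finset.range (c.natDegree + 1), c.coeff k * b (d + k) = 0) :
    ∃ p q : ℚ[X], q.coeff 0 ≠ 0 ∧ (q : ℚ⟦X⟧) * PowerSeries.mk b = (p : ℚ⟦X⟧) := by
  refine ⟨PowerSeries.trunc c.natDegree ((c.reverse : ℚ⟦X⟧) * PowerSeries.mk b), c.reverse, ?_, ?_⟩
  · rw [Polynomial.coeff_zero_reverse, hc]
    exact one_ne_zero
  · ext d
    rw [Polynomial.coeff_coe, PowerSeries.coeff_trunc]
    split_ifs with hd
    · rfl
    obtain ⟨e, rfl⟩ := Nat.exists_eq_add_of_le (not_lt.1 hd)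
    rw [PowerSeries.coeff_mul, Finset.Nat.sum_antidiagonal_eq_sum_range_succ
      (fun i j => PowerSeries.coeff i (c.reverse : ℚ⟦X⟧) * PowerSeries.coeff j (PowerSeries.mk b)),
      ← Finset.sum_subset (Finset.range_mono (by omega : c.natDegree + 1 ≤ (c.natDegree + e).succ)),
      ← hb e, ← Finset.sum_flip]
    · refine Finset.sum_congr rfl fun k hk => ?_
      have hk' : k ≤ c.natDegree := Nat.lt_succ_iff.1 (Finset.mem_range.1 hk)
      rw [Polynomial.coeff_coe, PowerSeries.coeff_mk, Polynomial.coeff_reverse,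
        Polynomial.revAt_le (Nat.sub_le _ _)]
      congr 2 <;> omega
    · intro k _ hk
      rw [Polynomial.coeff_coe, Polynomial.coeff_eq_zero_of_natDegree_lt, zero_mul]
      refine (Polynomial.reverse_natDegree_le c).trans_lt ?_
      simpa using hk

theorem Matrix.sum_charpoly_coeff_mul_pow_apply {ι : Type*} [Fintype ι] [DecidableEq ι]
    (A : Matrix ι ι ℚ) (i j : ι) (d : ℕ) :
    ∑ k ∈ Finset.range (A.charpoly.natDegree + 1), A.charpoly.coeff k * (A ^ (d + k)) i j = 0 := by
  have h := Matrix.aeval_self_charpoly A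
  rw [Polynomial.aeval_eq_sum_range] at h
  have h2 := congrArg (fun B => (A ^ d * B) i j) h
  simpa only [Finset.mul_sum, Matrix.sum_apply, mul_smul_comm, ← pow_add, Matrix.smul_apply,
    smul_eq_mul, Matrix.mul_zero, Matrix.zero_apply, mul_zero] using h2

end LinearAlgebra

/-! ### The incidence matrix on functions of the type, and the theorem. -/

section Conclusion

open Equiv

variable {m : ℕ}

theorem gen_dvd_iff {y : PosBraid (m + 1)} (hy : Reduced y) (i : Fin m) :
    gen i ∣ y ↔ i ∈ descents (permHom m y)⁻¹ := by
  rw [mem_descents]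
  constructor
  · rintro ⟨z, rfl⟩
    have hz := hy.of_mul_right
    rw [Reduced] at hy hz
    rw [len_mul, len_gen, hz, map_mul, permHom_gen] at hy
    have h1 : invNum ((permHom m z)⁻¹ * adjSwap i) = invNum (permHom m z)⁻¹ + 1 := by
      rw [← invNum_inv, mul_inv_rev, inv_inv, adjSwap_inv, ← hy, invNum_inv, add_comm]
    rw [invNum_mul_adjSwap_lt_iff] at h1
    simpa using h1
  · intro h
    have h1 := invNum_mul_adjSwap_of_gt h
    rw [← invNum_inv, mul_inv_rev, inv_inv, adjSwap_inv, invNum_inv] at h1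
    obtain ⟨z, hz, hzw⟩ := exists_reduced (adjSwap i * permHom m y)
    have h2 : permHom m (gen i * z) = permHom m y := by
      rw [map_mul, hzw, permHom_gen, ← mul_assoc, adjSwap_mul_self, one_mul]
    have h3 : Reduced (gen i * z) := by
      rw [Reduced, h2, len_mul, len_gen, hz, hzw, ← h1, add_comm]
    exact ⟨z, (h3.ext hy h2).symm⟩

theorem isNormal_pair_iff (x y : SimpleBraid (m + 1)) :
    IsNormal [(x : PosBraid (m + 1)), (y : PosBraid (m + 1))] ↔
      descents (permHom m y)⁻¹ ⊆ descents (permHom m x) := by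
  have hx := dvd_deltaBraid_iff.1 x.2
  have hy := dvd_deltaBraid_iff.1 y.2
  rw [IsNormal, isNormal_singleton, and_iff_left y.2, List.prod_singleton,
    isLeftGcd_deltaBraid_mul_iff, and_iff_right hx]
  refine forall_congr' fun i => ?_
  rw [gen_dvd_iff hy, hx.mul_gen_iff, not_lt, mem_descents (w := permHom m x)]
  exact imp_congr_right fun _ => (apply_castSucc_ne_succ _ _).symm.le_iff_lt

/-- Simple braids correspond to permutations. -/
noncomputable def simpleBraidEquiv (m : ℕ) : SimpleBraid (m + 1) ≃ Perm (Fin (m + 1)) :=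
  Equiv.ofBijective (fun x => permHom m x) (by
    constructor
    · intro x y h
      exact Subtype.ext ((dvd_deltaBraid_iff.1 x.2).ext (dvd_deltaBraid_iff.1 y.2) h)
    · intro w
      obtain ⟨x, hx, hw⟩ := exists_reduced w
      exact ⟨⟨x, hx.dvd_deltaBraid⟩, hw⟩)

/-- The longest element of the Young subgroup of `T`, found as the maximal representative of the
double coset of `1`. It preserves blocks, so it has no descent between two of them. -/
theorem exists_descents_eq (T : Finset (Fin m)) : ∃ w : Perm (Fin (m + 1)), descents w = T := by
  obtain ⟨a, ha, b, hb, h⟩ := exists_mem_maximalReps T T 1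
  refine ⟨a * 1 * b⁻¹, (mem_maximalReps.1 h).2.antisymm' fun i hi => ?_⟩
  by_contra hiT
  have hmem : a * 1 * b⁻¹ ∈ youngSubgroup T := mul_mem (mul_mem ha (one_mem _)) (inv_mem hb)
  have h1 := blockIndex_mono T (mem_descents.1 hi).le
  rw [hmem, hmem, blockIndex_succ_of_notMem hiT] at h1
  omega

/-- The functions on simple braids that depend only on the type of the left descent set. -/
def typeFunctions (m : ℕ) : Submodule ℂ (SimpleBraid (m + 1) → ℂ) where
  carrier := {v | ∃ f : Finset (Fin m) → ℂ, (∀ S T, SameType S T → f S = f T) ∧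
    ∀ x : SimpleBraid (m + 1), v x = f (descents (permHom m x)⁻¹)}
  zero_mem' := ⟨0, fun _ _ _ => rfl, fun _ => rfl⟩
  add_mem' := by
    rintro v w ⟨f, hf, hv⟩ ⟨g, hg, hw⟩
    exact ⟨f + g, fun S T h => congrArg₂ (· + ·) (hf S T h) (hg S T h),
      fun x => congrArg₂ (· + ·) (hv x) (hw x)⟩
  smul_mem' := by
    rintro c v ⟨f, hf, hv⟩
    exact ⟨c • f, fun S T h => congrArg (c • ·) (hf S T h), fun x => congrArg (c • ·) (hv x)⟩

open Classical in
theorem toLin_normalMatrix_apply {v : SimpleBraid (m + 1) → ℂ} {f : Finset (Fin m) → ℂ}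
    (hv : ∀ x : SimpleBraid (m + 1), v x = f (descents (permHom m x)⁻¹))
    (y : SimpleBraid (m + 1)) :
    Matrix.toLin' (normalMatrix (m + 1)).transpose v y =
      descentTransfer f (descents (permHom m y)⁻¹) := by
  rw [Matrix.toLin'_apply, Matrix.mulVec, dotProduct, descentTransfer,
    ← (simpleBraidEquiv m).sum_comp]
  refine Finset.sum_congr rfl fun x _ => ?_
  rw [Matrix.transpose_apply, normalMatrix, Matrix.of_apply, hv]
  simp only [isNormal_pair_iff, ite_mul, one_mul, zero_mul]
  rfl

open Classical in
theorem toLin_normalMatrix_mem {v : SimpleBraid (m + 1) → ℂ} (hv : v ∈ typeFunctions m) :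
    Matrix.toLin' (normalMatrix (m + 1)).transpose v ∈ typeFunctions m := by
  obtain ⟨f, -, hv⟩ := hv
  exact ⟨descentTransfer f, fun _ _ h => descentTransfer_sameType f h,
    toLin_normalMatrix_apply hv⟩

open Classical in
theorem eq_zero_of_toLin_normalMatrix_eq_zero {v : SimpleBraid (m + 1) → ℂ}
    (hv : v ∈ typeFunctions m) (h : Matrix.toLin' (normalMatrix (m + 1)).transpose v = 0) :
    v = 0 := by
  obtain ⟨f, hf, hv⟩ := hv
  have h0 : f = 0 := by
    refine eq_zero_of_descentTransfer_eq_zero hf fun T => ?_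
    obtain ⟨w, hw⟩ := exists_descents_eq T
    have h1 := congrFun h ((simpleBraidEquiv m).symm w⁻¹)
    have h2 : permHom m ((simpleBraidEquiv m).symm w⁻¹ : SimpleBraid (m + 1)) = w⁻¹ :=
      (simpleBraidEquiv m).apply_symm_apply w⁻¹
    rw [toLin_normalMatrix_apply hv, h2, inv_inv, hw] at h1
    exact h1
  funext x
  rw [hv, h0]
  rfl

open Classical in
-- `Δ` is the only simple braid for which all letters are left descents, and the full set of letters
-- is alone in its type, as type determines cardinality.
theorem single_simpleDelta_mem :
    Pi.single (simpleDelta (m + 1)) (1 : ℂ) ∈ typeFunctions m := by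
  refine ⟨fun S => if S = Finset.univ then 1 else 0, fun S T h => ?_, fun x => ?_⟩
  · simp only [← Finset.card_eq_iff_eq_univ, h.card_eq]
  · rw [Pi.single_apply]
    refine if_congr ?_ rfl rfl
    have hrev : (Fin.revPerm : Perm (Fin (m + 1)))⁻¹ = Fin.revPerm := rfl
    constructor
    · rintro rfl
      rw [simpleDelta, permHom_deltaBraid, hrev]
      ext i
      simp [mem_descents, Fin.lt_def]
      omega
    · intro h
      have h1 : (permHom m x)⁻¹ = Fin.revPerm := eq_revPerm_of_descents fun i =>
        mem_descents.1 (h ▸ Finset.mem_univ i)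
      apply (simpleBraidEquiv m).injective
      change permHom m x = permHom m (deltaBraid (m + 1))
      rw [permHom_deltaBraid, ← hrev, ← h1, inv_inv]

open Classical in
theorem braidCount_cast {R : Type*} [CommRing R] (d : ℕ) (x : SimpleBraid (m + 1)) :
    (braidCount (m + 1) d x : R) =
      ((natNormalMatrix (m + 1)).map (Nat.castRingHom R) ^ d) (simpleDelta (m + 1)) x := by
  rw [braidCount_eq_pow_apply, ← Matrix.map_pow]
  rfl

end Conclusion

theorem proposition2p9 (n : ℕ) (hn : 1 ≤ n) (x : SimpleBraid n) :
    (∃ P : ℂ → ℂ[X],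
      (∀ ρ ∈ nonzeroEigenvalues n, (P ρ).natDegree ≤ (normalCharpoly n).rootMultiplicity ρ) ∧
      ∀ d : ℕ, (braidCount n d x : ℂ) =
        ∑ ρ ∈ nonzeroEigenvalues n, (P ρ).eval (d : ℂ) * ρ ^ d) ∧
    (∃ p q : ℚ[X], q.coeff 0 ≠ 0 ∧
      (q : ℚ⟦X⟧) * PowerSeries.mk (fun d => (braidCount n d x : ℚ)) = (p : ℚ⟦X⟧)) := by
  classical
  obtain ⟨m, rfl⟩ := Nat.exists_eq_add_of_le' hn
  constructor
  -- The transpose turns the row of `Δ` in `M_n ^ d` into the vector `T ^ d` applied to `u`.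
  · set T := Matrix.toLin' (normalMatrix (m + 1)).transpose with hT
    set u : SimpleBraid (m + 1) → ℂ := Pi.single (simpleDelta (m + 1)) 1 with hu
    have hcount : ∀ d, (braidCount (m + 1) d x : ℂ) = LinearMap.proj (R := ℂ) x ((T ^ d) u) := by
      intro d
      rw [braidCount_cast, ← normalMatrix_eq_map, hT, ← Matrix.toLin'_pow, ← Matrix.transpose_pow,
        Matrix.toLin'_apply, hu, Matrix.mulVec_single_one]
      rfl
    have hpow : ∀ k, ∀ v ∈ typeFunctions m, (T ^ k) v = 0 → v = 0 := by
      intro k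
      induction k with
      | zero => exact fun v _ h => h
      | succ k ih =>
        intro v hv h
        rw [pow_succ, Module.End.mul_apply] at h
        exact eq_zero_of_toLin_normalMatrix_eq_zero hv (ih _ (toLin_normalMatrix_mem hv) h)
    have hchar : Polynomial.aeval T (normalCharpoly (m + 1)) = 0 := by
      have h1 : LinearMap.charpoly T = normalCharpoly (m + 1) := by
        rw [hT, Matrix.charpoly_toLin', Matrix.charpoly_transpose, normalCharpoly]
      rw [← h1, LinearMap.aeval_self_charpoly]
    -- The power of `X` can be removed from the characteristic polynomial: the product applied to
    -- `u` stays in `typeFunctions m`, where powers of `T` are injective. This is why no correction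
    -- is needed for small `d`.
    have hprod : Polynomial.aeval T (∏ ρ ∈ nonzeroEigenvalues (m + 1),
        (Polynomial.X - Polynomial.C ρ) ^ (normalCharpoly (m + 1)).rootMultiplicity ρ) u = 0 := by
      refine hpow ((normalCharpoly (m + 1)).rootMultiplicity 0) _
        (aeval_apply_mem (fun v hv => toLin_normalMatrix_mem hv) _ single_simpleDelta_mem) ?_
      have h1 := eq_X_pow_mul_prod_of_monic (Matrix.charpoly_monic (normalMatrix (m + 1)))
      change normalCharpoly (m + 1) = _ at h1
      rw [h1, map_mul, map_pow, Polynomial.aeval_X] at hchar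
      exact LinearMap.congr_fun hchar u
    simp only [hcount]
    exact exists_polynomials_of_aeval_prod_apply_eq_zero T (LinearMap.proj x) _ _
      (fun ρ hρ => (Finset.mem_erase.1 hρ).1) u hprod
  · simp only [braidCount_cast (R := ℚ)]
    exact exists_rational_generatingFunction (Matrix.charpoly_monic _)
      (Matrix.sum_charpoly_coeff_mul_pow_apply _ _ _)
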